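/- **Deduction Theorem for $\mathcal Q^{\mathrm u}_0$.** Let $\mathcal H$ be an arbitrary set of wffs of type $o$ of $\mathcal Q^{\mathrm u}_0$, and let $\mathbf H_o$, $\mathbf P_o$ be wffs of type $o$. If $\mathcal H\cup\{\mathbf H_o\}\vdash \mathbf P_o$, then $\mathcal H\vdash \mathbf H_o\supset\mathbf P_o$. Here $\mathcal Q^{\mathrm u}_0$ (Andrews' type theory with undefinedness) and $\vdash$ are as follows. *Syntax.* Type symbols: $\imath$, $o$, and $(\alpha\beta)$ for type symbols $\alpha,\beta$ (association to the left). For each type $\alpha$ there are denumerably many variables $f_\alpha,g_\alpha,h_\alpha,x_\alpha,y_\alpha,z_\alpha,f^1_\alpha,\dots$. The primitive constants are $\mathsf Q_{o\alpha\alpha}$ for each $\alpha$, $\iota_{\alpha(o\alpha)}$ for each $\alpha\ne o$, and an arbitrary family of nonlogical constants of various types. Variables and primitive constants of type $\alpha$ are wffs of type $\alpha$; $[\mathbf A_{\alpha\beta}\mathbf B_\beta]$ is a wff of type $\alpha$; $[\lambda\mathbf x_\beta\mathbf A_\alpha]$ is a wff of type $\alpha\beta$. $\mathsf S^{\mathbf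 x}_{\mathbf A}\mathbf B$ is the result of substituting $\mathbf A$ for each free occurrence of $\mathbf x$ in $\mathbf B$. *Abbreviations.* $[\mathbf A_\alpha=\mathbf B_\alpha]$ is $\mathsf Q_{o\alpha\alpha}\mathbf A_\alpha\mathbf B_\alpha$; $T_o$ is $\mathsf Q_{ooo}=\mathsf Q_{ooo}$; $F_o$ is $[\lambda x_oT_o]=[\lambda x_ox_o]$; $\forall\mathbf x_\alpha\mathbf A_o$ is $[\lambda y_\alpha T_o]=[\lambda\mathbf x_\alpha\mathbf A_o]$; $\wedge_{ooo}$ is $\lambda x_o\lambda y_o[[\lambda g_{ooo}[g_{ooo}T_oT_o]]=[\lambda g_{ooo}[g_{ooo}x_oy_o]]]$; $\supset_{ooo}$ is $\lambda x_o\lambda y_o[x_o=[x_o\wedge y_o]]$; ${\sim}_{oo}$ is $\mathsf Q_{ooo}F_o$; $\vee_{ooo}$ is $\lambda x_o\lambda y_o[{\sim}[[{\sim}x_o]\wedge[{\sim}y_o]]]$ (the connectives being written infix or prefix as usual); $\exists\mathbf x_\alpha\mathbf A_o$ is ${\sim}\forall\mathbf x_\alpha{\sim}\mathbf A_o$; $\exists_1\mathbf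 x_\alpha\mathbf A_o$ is $\exists \mathbf y_\alpha[[\lambda\mathbf x_\alpha\mathbf A_o]=\mathsf Q_{o\alpha\alpha}\mathbf y_\alpha]$, $\mathbf y_\alpha$ not occurring in $\mathbf A_o$; $\mathbf A_\alpha{\downarrow}$ is $\exists \mathbf x_\alpha[\mathbf x_\alpha=\mathbf A_\alpha]$, $\mathbf x_\alpha$ not occurring in $\mathbf A_\alpha$; $\mathbf A_\alpha{\uparrow}$ is ${\sim}[\mathbf A_\alpha{\downarrow}]$; $\mathbf A_\alpha\simeq\mathbf B_\alpha$ is $[\mathbf A_\alpha{\downarrow}\vee\mathbf B_\alpha{\downarrow}]\supset[\mathbf A_\alpha=\mathbf B_\alpha]$; $\mathrm I\mathbf x_\alpha\mathbf A_o$ is $\iota_{\alpha(o\alpha)}[\lambda\mathbf x_\alpha\mathbf A_o]$ ($\alpha\neq o$). Where an auxiliary bound variable is only required not to occur, any such variable may be used. *Axiom schemas.* - A1: $[g_{oo}T_o\wedge g_{oo}F_o]=\forall x_o[g_{oo}x_o]$. - A2: $[x_\alpha=y_\alpha]\supset[h_{o\alpha}x_\alpha=h_{o\alpha}y_\alpha]$.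 - A3: $[f_{\alpha\beta}=g_{\alpha\beta}]=\forall x_\beta[f_{\alpha\beta}x_\beta\simeq g_{\alpha\beta}x_\beta]$. - A4: $\mathbf A_\alpha{\downarrow}\supset[[\lambda\mathbf x_\alpha\mathbf B_\beta]\mathbf A_\alpha\simeq\mathsf S^{\mathbf x_\alpha}_{\mathbf A_\alpha}\mathbf B_\beta]$, provided $\mathbf A_\alpha$ is free for $\mathbf x_\alpha$ in $\mathbf B_\beta$. - A5: $\mathbf x_\alpha{\downarrow}$ for variables. - A6: $\mathbf c_\alpha{\downarrow}$ for primitive constants. - A7: $[\lambda\mathbf x_\alpha\mathbf B_\beta]{\downarrow}$. - A8: $[\mathbf A_{o\beta}\mathbf B_\beta]{\downarrow}$. - A9: $[\mathbf A_{o\beta}{\uparrow}\vee\mathbf B_\beta{\uparrow}]\supset{\sim}[\mathbf A_{o\beta}\mathbf B_\beta]$. - A10: $[\mathbf A_{\alpha\beta}{\uparrow}\vee\mathbf B_\beta{\uparrow}]\supset[\mathbf A_{\alpha\beta}\mathbf B_\beta]{\uparrow}$, $\alpha\ne o$. - A11: $\mathbf A_\alpha{\downarrow}\supset[\mathbf B_\alpha{\downarrow}\supset[[\mathbf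 A_\alpha\simeq\mathbf B_\alpha]\simeq[\mathbf A_\alpha=\mathbf B_\alpha]]]$. - A12: $\exists_1\mathbf x_\alpha\mathbf A_o\supset[[\mathrm I\mathbf x_\alpha\mathbf A_o]{\downarrow}\wedge\mathsf S^{\mathbf x_\alpha}_{\mathrm I\mathbf x_\alpha\mathbf A_o}\mathbf A_o]$, $\alpha\ne o$, provided $\mathrm I\mathbf x_\alpha\mathbf A_o$ is free for $\mathbf x_\alpha$ in $\mathbf A_o$. - A13: ${\sim}[\exists_1\mathbf x_\alpha\mathbf A_o]\supset[\mathrm I\mathbf x_\alpha\mathbf A_o]{\uparrow}$, $\alpha\ne o$. *Rules.* R1: from $\mathbf A_\alpha\simeq\mathbf B_\alpha$ and $\mathbf C_o$ infer the result of replacing one occurrence of $\mathbf A_\alpha$ in $\mathbf C_o$ (not a variable immediately preceded by $\lambda$) by $\mathbf B_\alpha$. R2: from $\mathbf A_o$ and $\mathbf A_o\supset\mathbf B_o$ infer $\mathbf B_o$. *Proofs.* A proof is a nonempty finite sequence of wffs of type $o$, each of which is an axiom instance or is inferred from preceding members by R1 or R2. $\mathcal H\vdash\mathbf A_o$ means that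 there are finite sequences $\mathcal S_1,\mathcal S_2$ of wffs of type $o$ such that $\mathcal S_1$ is a proof, $\mathbf A_o$ is the last member of $\mathcal S_2$, and each member of $\mathcal S_2$ is in $\mathcal H$, or is a member of $\mathcal S_1$, or is inferred from two preceding members of $\mathcal S_2$ by R2, or is inferred from two preceding members $\mathbf A_\alpha\simeq\mathbf B_\alpha$ and $\mathbf C_o$ of $\mathcal S_2$ by R1, provided that the replaced occurrence of $\mathbf A_\alpha$ in $\mathbf C_o$ is not in a well-formed part $\lambda\mathbf x_\beta\mathbf E_\gamma$ of $\mathbf C_o$ where $\mathbf x_\beta$ is free in a member of $\mathcal H$ and free in $\mathbf A_\alpha\simeq\mathbf B_\alpha$. -/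

import Mathlib

universe u

namespace Qu0

/-- Type symbols. `arr α β` is the type symbol `(αβ)`, the type of (partial or total) functions
from `β` to `α`. -/
inductive Ty : Type
  | i : Ty
  | o : Ty
  | arr : Ty → Ty → Ty
  deriving DecidableEq

open Ty

/-- The wffs of type `α` over a family `K` of nonlogical constants (`K α` is the set of nonlogical
constants of type `α`). The variables of type `α` are the `var α n`, `n : ℕ`, and distinct pairs
`(α, n)` are distinct variables. -/
inductive Wff (K : Ty → Type u) : Ty → Type u
  | var (α : Ty) (n : ℕ) : Wff K α
  | Q (α : Ty) : Wff K (arr (arr o α) α)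
  | iota (α : Ty) (hα : α ≠ o) : Wff K (arr α (arr o α))
  | cst {α : Ty} (c : K α) : Wff K α
  | app {α β : Ty} (A : Wff K (arr α β)) (B : Wff K β) : Wff K α
  | lam {α : Ty} (β : Ty) (n : ℕ) (A : Wff K α) : Wff K (arr α β)

namespace Wff

variable {K : Ty → Type u}

/-! ### Variables: occurrence, free occurrence, substitution -/

/-- The variable `var β n` occurs in the wff, free or bound or directly after a `λ`. -/
def Occurs (β : Ty) (n : ℕ) : {α : Ty} → Wff K α → Prop
  | _, var γ m => γ = β ∧ m = n
  | _, Q _ => False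
  | _, iota _ _ => False
  | _, cst _ => False
  | _, app A B => Occurs β n A ∨ Occurs β n B
  | _, lam γ m A => (γ = β ∧ m = n) ∨ Occurs β n A

/-- The variable `var β n` is free in the wff. -/
def Free (β : Ty) (n : ℕ) : {α : Ty} → Wff K α → Prop
  | _, var γ m => γ = β ∧ m = n
  | _, Q _ => False
  | _, iota _ _ => False
  | _, cst _ => False
  | _, app A B => Free β n A ∨ Free β n B
  | _, lam γ m A => ¬ (γ = β ∧ m = n) ∧ Free β n A

/-- The result of substituting `A` for each free occurrence of the variable `var β n`
(literally, without renaming of bound variables). -/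
def subst (β : Ty) (n : ℕ) (A : Wff K β) : {α : Ty} → Wff K α → Wff K α
  | _, var γ m => if h : β = γ ∧ n = m then h.1 ▸ A else var γ m
  | _, Q γ => Q γ
  | _, iota γ hγ => iota γ hγ
  | _, cst c => cst c
  | _, app B C => app (subst β n A B) (subst β n A C)
  | _, lam γ m B => if γ = β ∧ m = n then lam γ m B else lam γ m (subst β n A B)

/-- `A` is free for the variable `var β n` in the wff: no free occurrence of `var β n` lies in a
well-formed part `λ y C` such that `y` is free in `A`. -/
def FreeFor {δ : Ty} (A : Wff K δ) (β : Ty) (n : ℕ) : {α : Ty} → Wff K α → Prop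
  | _, var _ _ => True
  | _, Q _ => True
  | _, iota _ _ => True
  | _, cst _ => True
  | _, app B C => FreeFor A β n B ∧ FreeFor A β n C
  | _, lam γ m B => ¬ Free β n (lam γ m B) ∨ (¬ Free γ m A ∧ FreeFor A β n B)

/-! ### Particular variables, in the order `f, g, h, x, y, z, f¹, g¹, …` -/

def vf (α : Ty) : Wff K α := var α 0
def vg (α : Ty) : Wff K α := var α 1
def vh (α : Ty) : Wff K α := var α 2
def vx (α : Ty) : Wff K α := var α 3
def vy (α : Ty) : Wff K α := var α 4

/-- `λ x_α A` -/
def lamx (α : Ty) {β : Ty} (A : Wff K β) : Wff K (arr β α) := lam α 3 A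
/-- `λ y_α A` -/
def lamy (α : Ty) {β : Ty} (A : Wff K β) : Wff K (arr β α) := lam α 4 A
/-- `λ g_α A` -/
def lamg (α : Ty) {β : Ty} (A : Wff K β) : Wff K (arr β α) := lam α 1 A

/-! ### Defined logical constants and abbreviations -/

/-- `[A = B]` -/
def eq {α : Ty} (A B : Wff K α) : Wff K o := app (app (Q α) A) B

/-- `T_o` -/
def tt : Wff K o := eq (Q o) (Q o)

/-- `F_o` -/
def ff : Wff K o := eq (lamx o tt) (lamx o (vx o))

/-- `[∀ x A]`, where `x` is the variable `var α n` -/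
def all (α : Ty) (n : ℕ) (A : Wff K o) : Wff K o := eq (lamy α tt) (lam α n A)

/-- the type symbol `ooo` -/
abbrev ooo : Ty := arr (arr o o) o

/-- `∧_ooo` -/
def andC : Wff K ooo :=
  lamx o (lamy o
    (eq (lamg ooo (app (app (vg ooo) tt) tt)) (lamg ooo (app (app (vg ooo) (vx o)) (vy o)))))

/-- `[A ∧ B]` -/
def and (A B : Wff K o) : Wff K o := app (app andC A) B

/-- `⊃_ooo` -/
def impC : Wff K ooo := lamx o (lamy o (eq (vx o) (and (vx o) (vy o))))

/-- `[A ⊃ B]` -/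
def imp (A B : Wff K o) : Wff K o := app (app impC A) B

/-- `∼_oo` -/
def negC : Wff K (arr o o) := app (Q o) ff

/-- `[∼A]` -/
def neg (A : Wff K o) : Wff K o := app negC A

/-- `∨_ooo` -/
def orC : Wff K ooo := lamx o (lamy o (neg (and (neg (vx o)) (neg (vy o)))))

/-- `[A ∨ B]` -/
def or (A B : Wff K o) : Wff K o := app (app orC A) B

/-- `[∃ x A]`, where `x` is the variable `var α n` -/
def ex (α : Ty) (n : ℕ) (A : Wff K o) : Wff K o := neg (all α n (neg A))

/-- `[I x A]`, where `x` is the variable `var α n` -/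
def the (α : Ty) (hα : α ≠ o) (n : ℕ) (A : Wff K o) : Wff K α := app (iota α hα) (lam α n A)

/-! The next four abbreviations contain an auxiliary bound variable that is only required not to
occur in certain wffs. Each is therefore given as the relation between its arguments and the wffs
that it may stand for, one for every admissible auxiliary variable. -/

/-- `D` is `[∃₁ x A]`, where `x` is the variable `var α n`: that is, `D` is
`∃ y [[λ x A] = Q y]` for a variable `y` of type `α` that does not occur in `A`. -/
def IsExUnique (α : Ty) (n : ℕ) (A D : Wff K o) : Prop :=
  ∃ m : ℕ, ¬ Occurs α m A ∧ D = ex α m (eq (lam α n A) (app (Q α) (var α m)))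

/-- `D` is `[A ↓]` ("`A` is defined"): that is, `D` is `∃ x [x = A]` for a variable `x` of the
type of `A` that does not occur in `A`. -/
def IsDef {α : Ty} (A : Wff K α) (D : Wff K o) : Prop :=
  ∃ m : ℕ, ¬ Occurs α m A ∧ D = ex α m (eq (var α m) A)

/-- `U` is `[A ↑]` ("`A` is undefined"): that is, `U` is `∼[A ↓]`. -/
def IsUndef {α : Ty} (A : Wff K α) (U : Wff K o) : Prop :=
  ∃ D : Wff K o, IsDef A D ∧ U = neg D

/-- `E` is the quasi-equality `[A ≃ B]`: that is, `E` is `[A ↓ ∨ B ↓] ⊃ [A = B]`. -/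
def IsQuasiEq {α : Ty} (A B : Wff K α) (E : Wff K o) : Prop :=
  ∃ D₁ D₂ : Wff K o, IsDef A D₁ ∧ IsDef B D₂ ∧ E = imp (or D₁ D₂) (eq A B)

/-- The primitive constants, logical and nonlogical. -/
inductive IsPrimitiveConstant : {α : Ty} → Wff K α → Prop
  | Q (α : Ty) : IsPrimitiveConstant (Q α)
  | iota (α : Ty) (hα : α ≠ o) : IsPrimitiveConstant (iota α hα)
  | cst {α : Ty} (c : K α) : IsPrimitiveConstant (cst c)

/-! ### The proof system -/

/-- The instances of the thirteen axiom schemas. -/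
inductive IsAxiom : Wff K o → Prop
  /-- Truth values: `[g T ∧ g F] = ∀ x [g x]`. -/
  | a1 :
      IsAxiom (eq (and (app (vg (arr o o)) tt) (app (vg (arr o o)) ff))
        (all o 3 (app (vg (arr o o)) (vx o))))
  /-- Leibniz' law: `[x = y] ⊃ [h x = h y]`. -/
  | a2 (α : Ty) :
      IsAxiom (imp (eq (vx α) (vy α))
        (eq (app (vh (arr o α)) (vx α)) (app (vh (arr o α)) (vy α))))
  /-- Extensionality: `[f = g] = ∀ x [f x ≃ g x]`. -/
  | a3 (α β : Ty) (E : Wff K o) :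
      IsQuasiEq (app (vf (arr α β)) (vx β)) (app (vg (arr α β)) (vx β)) E →
      IsAxiom (eq (eq (vf (arr α β)) (vg (arr α β))) (all β 3 E))
  /-- Beta-reduction: `A ↓ ⊃ [[λ x B] A ≃ S^x_A B]`, provided `A` is free for `x` in `B`. -/
  | a4 {α β : Ty} (n : ℕ) (A : Wff K α) (B : Wff K β) (D E : Wff K o) :
      FreeFor A α n B → IsDef A D → IsQuasiEq (app (lam α n B) A) (subst α n A B) E →
      IsAxiom (imp D E)
  /-- Variables are defined: `x ↓`. -/
  | a5 (α : Ty) (n : ℕ) (D : Wff K o) : IsDef (var α n) D → IsAxiom D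
  /-- Primitive constants are defined: `c ↓`. -/
  | a6 {α : Ty} (c : Wff K α) (D : Wff K o) : IsPrimitiveConstant c → IsDef c D → IsAxiom D
  /-- Function abstractions are defined: `[λ x B] ↓`. -/
  | a7 {β : Ty} (α : Ty) (n : ℕ) (B : Wff K β) (D : Wff K o) : IsDef (lam α n B) D → IsAxiom D
  /-- Function applications of type `o` are defined: `[A B] ↓`. -/
  | a8 {β : Ty} (A : Wff K (arr o β)) (B : Wff K β) (D : Wff K o) : IsDef (app A B) D → IsAxiom D
  /-- Improper function application of type `o`: `[A ↑ ∨ B ↑] ⊃ ∼[A B]`. -/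
  | a9 {β : Ty} (A : Wff K (arr o β)) (B : Wff K β) (U₁ U₂ : Wff K o) :
      IsUndef A U₁ → IsUndef B U₂ → IsAxiom (imp (or U₁ U₂) (neg (app A B)))
  /-- Improper function application of type `α ≠ o`: `[A ↑ ∨ B ↑] ⊃ [A B] ↑`. -/
  | a10 {α β : Ty} (A : Wff K (arr α β)) (B : Wff K β) (U₁ U₂ U₃ : Wff K o) :
      α ≠ o → IsUndef A U₁ → IsUndef B U₂ → IsUndef (app A B) U₃ →
      IsAxiom (imp (or U₁ U₂) U₃)
  /-- Equality and quasi-equality: `A ↓ ⊃ [B ↓ ⊃ [[A ≃ B] ≃ [A = B]]]`. -/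
  | a11 {α : Ty} (A B : Wff K α) (D₁ D₂ E G : Wff K o) :
      IsDef A D₁ → IsDef B D₂ → IsQuasiEq A B E → IsQuasiEq E (eq A B) G →
      IsAxiom (imp D₁ (imp D₂ G))
  /-- Proper definite description: `[∃₁ x A] ⊃ [[I x A] ↓ ∧ S^x_{I x A} A]`, provided `I x A` is
  free for `x` in `A`. -/
  | a12 (α : Ty) (hα : α ≠ o) (n : ℕ) (A U D : Wff K o) :
      FreeFor (the α hα n A) α n A → IsExUnique α n A U → IsDef (the α hα n A) D →
      IsAxiom (imp U (and D (subst α n (the α hα n A) A)))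
  /-- Improper definite description: `∼[∃₁ x A] ⊃ [I x A] ↑`. -/
  | a13 (α : Ty) (hα : α ≠ o) (n : ℕ) (A U V : Wff K o) :
      IsExUnique α n A U → IsUndef (the α hα n A) V → IsAxiom (imp (neg U) V)

/-- `Repl A B vs C D`: `D` is the result of replacing one occurrence of `A` in `C` (not an
occurrence of a variable directly after a `λ`) by an occurrence of `B`, and `vs` lists the
variables `x` such that this occurrence lies in a well-formed part `λ x E` of `C`. -/
inductive Repl {α : Ty} (A B : Wff K α) :
    List (Ty × ℕ) → {γ : Ty} → Wff K γ → Wff K γ → Prop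
  | here : Repl A B [] A B
  | appLeft {γ δ : Ty} {vs : List (Ty × ℕ)} {C D : Wff K (arr γ δ)} (E : Wff K δ) :
      Repl A B vs C D → Repl A B vs (app C E) (app D E)
  | appRight {γ δ : Ty} {vs : List (Ty × ℕ)} {C D : Wff K δ} (E : Wff K (arr γ δ)) :
      Repl A B vs C D → Repl A B vs (app E C) (app E D)
  | lam {γ : Ty} {vs : List (Ty × ℕ)} {C D : Wff K γ} (β : Ty) (n : ℕ) :
      Repl A B vs C D → Repl A B ((β, n) :: vs) (lam β n C) (lam β n D)

/-- Rule R1: `D` is inferred from `E`, which is some `A ≃ B`, and `C`, by replacing one occurrence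
of `A` in `C` by `B`. -/
def RuleR1 (E C D : Wff K o) : Prop :=
  ∃ (α : Ty) (A B : Wff K α) (vs : List (Ty × ℕ)), IsQuasiEq A B E ∧ Repl A B vs C D

/-- Rule R1 as it may be used in a proof from `H`: the occurrence of `A` in `C` is not in a
well-formed part `λ x G` of `C` where `x` is free in a member of `H` and free in `A ≃ B`. -/
def RuleR1From (H : Set (Wff K o)) (E C D : Wff K o) : Prop :=
  ∃ (α : Ty) (A B : Wff K α) (vs : List (Ty × ℕ)), IsQuasiEq A B E ∧ Repl A B vs C D ∧
    ∀ v ∈ vs, ¬ ((∃ G ∈ H, Free v.1 v.2 G) ∧ Free v.1 v.2 E)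

/-- Rule R2 (modus ponens): `D` is inferred from `C` and `E`, where `E` is `C ⊃ D`. -/
def RuleR2 (C E D : Wff K o) : Prop := E = imp C D

/-- `D` is a member of the sequence `S` that precedes position `k`. -/
def Precedes (S : List (Wff K o)) (k : Fin S.length) (D : Wff K o) : Prop :=
  ∃ j : Fin S.length, j < k ∧ S.get j = D

/-- `S` is a proof (of its last member). -/
def IsProof (S : List (Wff K o)) : Prop :=
  S ≠ [] ∧ ∀ k : Fin S.length,
    IsAxiom (S.get k) ∨
    (∃ E C, Precedes S k E ∧ Precedes S k C ∧ RuleR1 E C (S.get k)) ∨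
    (∃ C E, Precedes S k C ∧ Precedes S k E ∧ RuleR2 C E (S.get k))

/-- The two sequences `S₁`, `S₂` are a proof of `A` from `H`. -/
def IsProofFrom (H : Set (Wff K o)) (S₁ S₂ : List (Wff K o)) (A : Wff K o) : Prop :=
  IsProof S₁ ∧ S₂.getLast? = some A ∧ ∀ k : Fin S₂.length,
    S₂.get k ∈ H ∨
    S₂.get k ∈ S₁ ∨
    (∃ E C, Precedes S₂ k E ∧ Precedes S₂ k C ∧ RuleR1From H E C (S₂.get k)) ∨
    (∃ C E, Precedes S₂ k C ∧ Precedes S₂ k E ∧ RuleR2 C E (S₂.get k))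

/-- `H ⊢ A`: there is a proof of `A` from `H`. -/
def Proves (H : Set (Wff K o)) (A : Wff K o) : Prop :=
  ∃ S₁ S₂ : List (Wff K o), IsProofFrom H S₁ S₂ A

end Wff

end Qu0

namespace Qu0

open Ty

/-! The proof is an induction on a derivation of `P` from `H ∪ {A}` that yields `A ⊃ P` from `H`.
Hypotheses, theorems and modus ponens need only a few tautologies; the substance is R1. Suppose R1
uses `E`, which is `B ≃ B'`, to turn `C` into `D`, at an occurrence lying under binders for the
variables `vs`. Let `X` be `E` generalized over those of `vs` that are free in it
(`exists_generalization`). By the side condition of R1 these variables are free neither in `H` nor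
in `A`, so `A ⊃ E` gives `A ⊃ X`. No member of `vs` is free in `X`, so an induction on the context
proves the theorem `X ⊃ [C ≃ D]` (`thm_imp_repl`); at type `o` this gives `X ⊃ [C ⊃ D]`, and `A ⊃ C`
then gives `A ⊃ D`. The difficulty in `thm_imp_repl` is that the parts compared may be undefined,
whereas substitution and Leibniz' law apply only to defined wffs. The remedy is to compare `λ z C`
and `λ z D` with a vacuous variable `z`: abstractions are always defined, extensionality makes them
equal when `C ≃ D`, and applying them to `z` recovers `C` and `D`. The logic needed for this is
built from the axioms. In hypothesis-free proofs R1 is unrestricted, so provable quasi-equality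
`QEq` is a congruence, and most arguments are calculations with it. Extensionality yields eta and
alpha conversion; A1 yields reasoning by cases on truth values (`QEq.of_cases`), from which the
tautologies and the law `QEq.all_imp` for quantifiers follow. -/

theorem Ty.arr_ne_left (α β : Ty) : arr α β ≠ α := by
  intro h; have := congrArg sizeOf h; simp at this; omega

/-- No type is a proper part of itself. So a variable of a function type never clashes with one of
its argument or value type, which settles many freshness conditions without renaming. -/
theorem Ty.arr_ne_right (α β : Ty) : arr α β ≠ β := by
  intro h; have := congrArg sizeOf h; simp at this

namespace Wff

variable {K : Ty → Type u}

/-! ### Free variables and substitution -/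

/-- A strict upper bound for the indices of the variables that occur in a wff. -/
def bd : {α : Ty} → Wff K α → ℕ
  | _, var _ m => m + 1
  | _, Q _ => 0
  | _, iota _ _ => 0
  | _, cst _ => 0
  | _, app A B => max (bd A) (bd B)
  | _, lam _ m A => max (m + 1) (bd A)

theorem Occurs.lt_bd {β : Ty} {n : ℕ} {α : Ty} {A : Wff K α} (h : Occurs β n A) : n < bd A := by
  induction A with
  | var γ m => simp only [Occurs, bd] at *; omega
  | Q => simp [Occurs] at h
  | iota => simp [Occurs] at h
  | cst => simp [Occurs] at h
  | app A B hA hB =>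
    simp only [Occurs, bd] at *
    rcases h with h | h
    · exact lt_max_of_lt_left (hA h)
    · exact lt_max_of_lt_right (hB h)
  | lam γ m A hA =>
    simp only [Occurs, bd] at *
    rcases h with h | h
    · exact lt_max_of_lt_left (by omega)
    · exact lt_max_of_lt_right (hA h)

/-- The source of fresh variables. Since `bd` ignores types, one index is fresh at all types at
once. -/
theorem not_occurs_of_bd_le {β : Ty} {n : ℕ} {α : Ty} {A : Wff K α} (h : bd A ≤ n) :
    ¬ Occurs β n A := fun h' => absurd h'.lt_bd (by omega)

theorem Free.occurs {β : Ty} {n : ℕ} {α : Ty} {A : Wff K α} (h : Free β n A) : Occurs β n A := by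
  induction A with
  | var γ m => exact h
  | Q => exact h
  | iota => exact h
  | cst => exact h
  | app A B hA hB => exact h.imp hA hB
  | lam γ m A hA => exact Or.inr (hA h.2)

theorem not_free_of_bd_le {β : Ty} {n : ℕ} {α : Ty} {A : Wff K α} (h : bd A ≤ n) :
    ¬ Free β n A := fun h' => not_occurs_of_bd_le h h'.occurs

theorem subst_of_not_free {β : Ty} {n : ℕ} (A : Wff K β) {α : Ty} {B : Wff K α}
    (h : ¬ Free β n B) : subst β n A B = B := by
  induction B with
  | var γ m =>
    simp only [Free, subst] at *
    rw [dif_neg]; rintro ⟨rfl, rfl⟩; exact h ⟨rfl, rfl⟩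
  | Q => rfl
  | iota => rfl
  | cst => rfl
  | app C D hC hD =>
    simp only [Free, not_or, subst] at *
    rw [hC h.1, hD h.2]
  | lam γ m C hC =>
    simp only [Free, subst] at *
    split_ifs with h'
    · rfl
    · rw [hC (fun hf => h ⟨h', hf⟩)]

theorem freeFor_of_not_free {δ β : Ty} {n : ℕ} (A : Wff K δ) {α : Ty} {B : Wff K α}
    (h : ¬ Free β n B) : FreeFor A β n B := by
  induction B with
  | var γ m => trivial
  | Q => trivial
  | iota => trivial
  | cst => trivial
  | app C D hC hD =>
    simp only [Free, not_or, FreeFor] at *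
    exact ⟨hC h.1, hD h.2⟩
  | lam γ m C hC => exact Or.inl h

theorem freeFor_of_closed {δ β : Ty} {n : ℕ} {A : Wff K δ} (h : ∀ γ m, ¬ Free γ m A)
    {α : Ty} (B : Wff K α) : FreeFor A β n B := by
  induction B with
  | var γ m => trivial
  | Q => trivial
  | iota => trivial
  | cst => trivial
  | app C D hC hD => exact ⟨hC, hD⟩
  | lam γ m C hC => exact Or.inr ⟨h _ _, hC⟩

theorem subst_var_self (β : Ty) (n : ℕ) {α : Ty} (B : Wff K α) :
    subst β n (var β n) B = B := by
  induction B with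
  | var γ m =>
    simp only [subst]
    split_ifs with h
    · obtain ⟨rfl, rfl⟩ := h; rfl
    · rfl
  | Q => rfl
  | iota => rfl
  | cst => rfl
  | app C D hC hD => simp only [subst, hC, hD]
  | lam γ m C hC => simp only [subst, hC, ite_self]

theorem freeFor_var_self (β : Ty) (n : ℕ) {α : Ty} (B : Wff K α) :
    FreeFor (var β n : Wff K β) β n B := by
  induction B with
  | var γ m => trivial
  | Q => trivial
  | iota => trivial
  | cst => trivial
  | app C D hC hD => exact ⟨hC, hD⟩
  | lam γ m C hC =>
    simp only [FreeFor, Free]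
    by_cases h : γ = β ∧ m = n
    · exact Or.inl (fun h' => h'.1 h)
    · exact Or.inr ⟨fun h' => h ⟨h'.1.symm, h'.2.symm⟩, hC⟩

@[simp] theorem subst_var_eq (β : Ty) (n : ℕ) (A : Wff K β) : subst β n A (var β n) = A := by
  simp [subst]

/-! ### The connectives under `Free`, `subst` and `FreeFor` -/

section Connectives

variable (β : Ty) (n : ℕ)

@[simp] theorem not_free_tt : ¬ Free β n (tt : Wff K o) := by simp [tt, eq, Free]
@[simp] theorem not_free_lamy_tt (α : Ty) : ¬ Free β n (lamy α (tt : Wff K o)) := by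
  simp [lamy, Free]
@[simp] theorem not_free_ff : ¬ Free β n (ff : Wff K o) := by
  simp [ff, eq, lamx, vx, Free]
@[simp] theorem not_free_andC : ¬ Free β n (andC : Wff K ooo) := by
  simp [andC, lamx, lamy, lamg, vx, vy, vg, eq, Free]; tauto
@[simp] theorem not_free_impC : ¬ Free β n (impC : Wff K ooo) := by
  simp [impC, lamx, lamy, vx, vy, eq, and, Free]; tauto
@[simp] theorem not_free_negC : ¬ Free β n (negC : Wff K (arr o o)) := by
  simp [negC, Free]
@[simp] theorem not_free_orC : ¬ Free β n (orC : Wff K ooo) := by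
  simp [orC, lamx, lamy, vx, vy, neg, and, Free]; tauto

@[simp] theorem free_eq {α : Ty} (A B : Wff K α) :
    Free β n (eq A B) ↔ Free β n A ∨ Free β n B := by simp [eq, Free]
@[simp] theorem free_imp (A B : Wff K o) :
    Free β n (imp A B) ↔ Free β n A ∨ Free β n B := by simp [imp, Free]
@[simp] theorem free_or (A B : Wff K o) :
    Free β n (or A B) ↔ Free β n A ∨ Free β n B := by simp [or, Free]
@[simp] theorem free_neg (A : Wff K o) : Free β n (neg A) ↔ Free β n A := by simp [neg, Free]
@[simp] theorem free_lam {γ α : Ty} (m : ℕ) (A : Wff K α) :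
    Free β n (lam γ m A) ↔ ¬ (γ = β ∧ m = n) ∧ Free β n A := Iff.rfl
@[simp] theorem free_app {γ α : Ty} (A : Wff K (arr α γ)) (B : Wff K γ) :
    Free β n (app A B) ↔ Free β n A ∨ Free β n B := Iff.rfl
@[simp] theorem free_var (γ : Ty) (m : ℕ) :
    Free β n (var γ m : Wff K γ) ↔ γ = β ∧ m = n := Iff.rfl
@[simp] theorem free_all (α : Ty) (m : ℕ) (A : Wff K o) :
    Free β n (all α m A) ↔ ¬ (α = β ∧ m = n) ∧ Free β n A := by simp [all]

variable (C : Wff K β)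

@[simp] theorem subst_tt : subst β n C (tt : Wff K o) = tt := subst_of_not_free _ (by simp)
@[simp] theorem subst_ff : subst β n C (ff : Wff K o) = ff := subst_of_not_free _ (by simp)
@[simp] theorem subst_app {γ α : Ty} (A : Wff K (arr α γ)) (B : Wff K γ) :
    subst β n C (app A B) = app (subst β n C A) (subst β n C B) := rfl
@[simp] theorem subst_eq {α : Ty} (A B : Wff K α) :
    subst β n C (eq A B) = eq (subst β n C A) (subst β n C B) := rfl
@[simp] theorem subst_and (A B : Wff K o) :
    subst β n C (and A B) = and (subst β n C A) (subst β n C B) := by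
  simp [and, subst_of_not_free]
@[simp] theorem subst_imp (A B : Wff K o) :
    subst β n C (imp A B) = imp (subst β n C A) (subst β n C B) := by
  simp [imp, subst_of_not_free]
@[simp] theorem subst_or (A B : Wff K o) :
    subst β n C (or A B) = or (subst β n C A) (subst β n C B) := by
  simp [or, subst_of_not_free]
@[simp] theorem subst_neg (A : Wff K o) :
    subst β n C (neg A) = neg (subst β n C A) := by
  simp [neg, subst_of_not_free]
theorem subst_lam {γ α : Ty} (m : ℕ) (A : Wff K α) (h : ¬ (γ = β ∧ m = n)) :
    subst β n C (lam γ m A) = lam γ m (subst β n C A) := by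
  simp only [subst, if_neg h]
theorem subst_var_ne {γ : Ty} (m : ℕ) (h : ¬ (γ = β ∧ m = n)) :
    subst β n C (var γ m) = var γ m := subst_of_not_free _ h
theorem subst_all {γ : Ty} (m : ℕ) (A : Wff K o) (h : ¬ (γ = β ∧ m = n)) :
    subst β n C (all γ m A) = all γ m (subst β n C A) := by
  simp [all, subst_lam _ _ _ _ _ h, subst_of_not_free]

variable {β n} {δ : Ty} {D : Wff K δ}

@[simp] theorem freeFor_app {γ α : Ty} (A : Wff K (arr α γ)) (B : Wff K γ) :
    FreeFor D β n (app A B) ↔ FreeFor D β n A ∧ FreeFor D β n B := Iff.rfl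
@[simp] theorem freeFor_var (γ : Ty) (m : ℕ) :
    FreeFor D β n (var γ m : Wff K γ) := trivial
@[simp] theorem freeFor_tt : FreeFor D β n (tt : Wff K o) := freeFor_of_not_free _ (by simp)
@[simp] theorem freeFor_ff : FreeFor D β n (ff : Wff K o) := freeFor_of_not_free _ (by simp)
@[simp] theorem freeFor_eq {α : Ty} (A B : Wff K α) :
    FreeFor D β n (eq A B) ↔ FreeFor D β n A ∧ FreeFor D β n B := by
  simp [eq, FreeFor]
@[simp] theorem freeFor_and (A B : Wff K o) :
    FreeFor D β n (and A B) ↔ FreeFor D β n A ∧ FreeFor D β n B := by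
  simp [and, freeFor_of_not_free]
@[simp] theorem freeFor_imp (A B : Wff K o) :
    FreeFor D β n (imp A B) ↔ FreeFor D β n A ∧ FreeFor D β n B := by
  simp [imp, freeFor_of_not_free]
@[simp] theorem freeFor_or (A B : Wff K o) :
    FreeFor D β n (or A B) ↔ FreeFor D β n A ∧ FreeFor D β n B := by
  simp [or, freeFor_of_not_free]
@[simp] theorem freeFor_neg (A : Wff K o) :
    FreeFor D β n (neg A) ↔ FreeFor D β n A := by
  simp [neg, freeFor_of_not_free]
theorem freeFor_lam {γ α : Ty} {m : ℕ} {A : Wff K α} (h : ¬ Free γ m D)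
    (h' : FreeFor D β n A) : FreeFor D β n (lam γ m A) := Or.inr ⟨h, h'⟩
theorem freeFor_all {γ : Ty} {m : ℕ} {A : Wff K o} (h : ¬ Free γ m D)
    (h' : FreeFor D β n A) : FreeFor D β n (all γ m A) := by
  simp [all, freeFor_of_not_free, freeFor_lam h h']

end Connectives

/-! ### Definedness and quasi-equality with explicit auxiliary variables -/

/-- `[A ↓]` with the auxiliary variable `var α m`. -/
def df {α : Ty} (m : ℕ) (A : Wff K α) : Wff K o := ex α m (eq (var α m) A)

/-- `[A ≃ B]` with the auxiliary variables `var α m` and `var α k`. -/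
def qe {α : Ty} (m k : ℕ) (A B : Wff K α) : Wff K o := imp (or (df m A) (df k B)) (eq A B)

theorem isDef_df {α : Ty} {m : ℕ} {A : Wff K α} (h : ¬ Occurs α m A) : IsDef A (df m A) :=
  ⟨m, h, rfl⟩

theorem isQuasiEq_qe {α : Ty} {m k : ℕ} {A B : Wff K α} (hA : ¬ Occurs α m A)
    (hB : ¬ Occurs α k B) : IsQuasiEq A B (qe m k A B) :=
  ⟨_, _, isDef_df hA, isDef_df hB, rfl⟩

theorem isQuasiEq_iff {α : Ty} {A B : Wff K α} {E : Wff K o} :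
    IsQuasiEq A B E ↔ ∃ m k, ¬ Occurs α m A ∧ ¬ Occurs α k B ∧ E = qe m k A B := by
  constructor
  · rintro ⟨_, _, ⟨m, hm, rfl⟩, ⟨k, hk, rfl⟩, rfl⟩
    exact ⟨m, k, hm, hk, rfl⟩
  · rintro ⟨m, k, hm, hk, rfl⟩
    exact isQuasiEq_qe hm hk

theorem subst_df {β : Ty} {n : ℕ} (C : Wff K β) {α : Ty} {m : ℕ} (A : Wff K α)
    (h : ¬ (α = β ∧ m = n)) : subst β n C (df m A) = df m (subst β n C A) := by
  simp [df, ex, subst_all _ _ _ _ _ h, subst_var_ne _ _ _ _ h]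

theorem subst_qe {β : Ty} {n : ℕ} (C : Wff K β) {α : Ty} {m k : ℕ} (A B : Wff K α)
    (h : ¬ (α = β ∧ m = n)) (h' : ¬ (α = β ∧ k = n)) :
    subst β n C (qe m k A B) = qe m k (subst β n C A) (subst β n C B) := by
  simp [qe, subst_df, h, h']

theorem freeFor_df {δ β : Ty} {n : ℕ} {C : Wff K δ} {α : Ty} {m : ℕ} {A : Wff K α}
    (h : ¬ Free α m C) (hA : FreeFor C β n A) : FreeFor C β n (df m A) := by
  simp only [df, ex, freeFor_neg]
  exact freeFor_all h (by simpa using hA)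

theorem freeFor_qe {δ β : Ty} {n : ℕ} {C : Wff K δ} {α : Ty} {m k : ℕ} {A B : Wff K α}
    (h : ¬ Free α m C) (h' : ¬ Free α k C) (hA : FreeFor C β n A) (hB : FreeFor C β n B) :
    FreeFor C β n (qe m k A B) := by
  simp [qe, freeFor_df, h, h', hA, hB]

/-! ### Derivability as an inductive predicate -/

/-- What is obtained from the members of `J` by the rules `R` and modus ponens. -/
inductive Der (J : Wff K o → Prop) (R : Wff K o → Wff K o → Wff K o → Prop) : Wff K o → Prop
  | base {A : Wff K o} : J A → Der J R A
  | rule {E C D : Wff K o} : Der J R E → Der J R C → R E C D → Der J R D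
  | mp {C D : Wff K o} : Der J R C → Der J R (imp C D) → Der J R D

/-- Every member of the sequence is in `J` or is inferred from preceding members. -/
def Valid (J : Wff K o → Prop) (R : Wff K o → Wff K o → Wff K o → Prop) (S : List (Wff K o)) :
    Prop :=
  ∀ k : Fin S.length,
    J (S.get k) ∨
    (∃ E C, Precedes S k E ∧ Precedes S k C ∧ R E C (S.get k)) ∨
    (∃ C E, Precedes S k C ∧ Precedes S k E ∧ RuleR2 C E (S.get k))

section Sequences

variable {J : Wff K o → Prop} {R : Wff K o → Wff K o → Wff K o → Prop}

theorem precedes_iff {S : List (Wff K o)} {k : Fin S.length} {D : Wff K o} :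
    Precedes S k D ↔ ∃ j : ℕ, j < k.1 ∧ S[j]? = some D := by
  constructor
  · rintro ⟨j, hj, rfl⟩
    exact ⟨j, hj, by simp⟩
  · rintro ⟨j, hj, h⟩
    obtain ⟨hl, h⟩ := List.getElem?_eq_some_iff.1 h
    exact ⟨⟨j, hl⟩, hj, h⟩

theorem valid_iff {S : List (Wff K o)} : Valid J R S ↔ ∀ (k : ℕ) (D : Wff K o), S[k]? = some D →
    J D ∨
    (∃ E C, (∃ j : ℕ, j < k ∧ S[j]? = some E) ∧ (∃ j : ℕ, j < k ∧ S[j]? = some C) ∧ R E C D) ∨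
    (∃ C E, (∃ j : ℕ, j < k ∧ S[j]? = some C) ∧ (∃ j : ℕ, j < k ∧ S[j]? = some E) ∧
      RuleR2 C E D) := by
  simp only [Valid, precedes_iff]
  constructor
  · intro h k D hD
    obtain ⟨hl, rfl⟩ := List.getElem?_eq_some_iff.1 hD
    exact h ⟨k, hl⟩
  · intro h k
    exact h k _ (by simp)

theorem Valid.der {S : List (Wff K o)} (h : Valid J R S) {D : Wff K o} (hD : D ∈ S) :
    Der J R D := by
  rw [valid_iff] at h
  obtain ⟨k, hk⟩ := List.mem_iff_getElem?.1 hD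
  clear hD
  induction k using Nat.strong_induction_on generalizing D with
  | _ k ih =>
    rcases h k D hk with h | ⟨E, C, ⟨i, hi, hE⟩, ⟨j, hj, hC⟩, hR⟩ |
      ⟨C, E, ⟨i, hi, hC⟩, ⟨j, hj, hE⟩, rfl⟩
    · exact .base h
    · exact .rule (ih i hi hE) (ih j hj hC) hR
    · exact .mp (ih i hi hC) (ih j hj hE)

theorem Valid.append {S S' : List (Wff K o)} (h : Valid J R S) (h' : Valid J R S') :
    Valid J R (S ++ S') := by
  rw [valid_iff] at *
  have key : ∀ (k : ℕ) (D : Wff K o), (∃ j : ℕ, j < k ∧ S'[j]? = some D) →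
      ∃ j : ℕ, j < S.length + k ∧ (S ++ S')[j]? = some D := by
    rintro k D ⟨j, hj, hD⟩
    exact ⟨S.length + j, by omega, by
      rwa [List.getElem?_append_right (by omega), Nat.add_sub_cancel_left]⟩
  have key' : ∀ (k : ℕ) (D : Wff K o), (∃ j : ℕ, j < k ∧ S[j]? = some D) →
      ∃ j : ℕ, j < k ∧ (S ++ S')[j]? = some D := by
    rintro k D ⟨j, hj, hD⟩
    exact ⟨j, hj, List.getElem?_append_left (List.getElem?_eq_some_iff.1 hD).1 ▸ hD⟩
  intro k D hD
  rcases lt_or_ge k S.length with hk | hk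
  · rw [List.getElem?_append_left hk] at hD
    rcases h k D hD with h | ⟨E, C, hE, hC, hR⟩ | ⟨C, E, hC, hE, hR⟩
    · exact .inl h
    · exact .inr (.inl ⟨E, C, key' _ _ hE, key' _ _ hC, hR⟩)
    · exact .inr (.inr ⟨C, E, key' _ _ hC, key' _ _ hE, hR⟩)
  · obtain ⟨k, rfl⟩ := Nat.exists_eq_add_of_le hk
    rw [List.getElem?_append_right hk, Nat.add_sub_cancel_left] at hD
    rcases h' k D hD with h | ⟨E, C, hE, hC, hR⟩ | ⟨C, E, hC, hE, hR⟩
    · exact .inl h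
    · exact .inr (.inl ⟨E, C, key _ _ hE, key _ _ hC, hR⟩)
    · exact .inr (.inr ⟨C, E, key _ _ hC, key _ _ hE, hR⟩)

theorem Valid.concat {S : List (Wff K o)} (h : Valid J R S) {D : Wff K o}
    (hD : J D ∨ (∃ E C, E ∈ S ∧ C ∈ S ∧ R E C D) ∨ (∃ C E, C ∈ S ∧ E ∈ S ∧ RuleR2 C E D)) :
    Valid J R (S ++ [D]) := by
  rw [valid_iff] at *
  have key' : ∀ (k : ℕ) (D' : Wff K o), (∃ j : ℕ, j < k ∧ S[j]? = some D') →
      ∃ j : ℕ, j < k ∧ (S ++ [D])[j]? = some D' := by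
    rintro k D' ⟨j, hj, hD⟩
    exact ⟨j, hj, List.getElem?_append_left (List.getElem?_eq_some_iff.1 hD).1 ▸ hD⟩
  have key : ∀ D', D' ∈ S → ∃ j : ℕ, j < S.length ∧ (S ++ [D])[j]? = some D' := by
    intro D' hD'
    obtain ⟨j, hj⟩ := List.mem_iff_getElem?.1 hD'
    exact key' _ _ ⟨j, (List.getElem?_eq_some_iff.1 hj).1, hj⟩
  intro k D' hD'
  rcases lt_or_ge k S.length with hk | hk
  · rw [List.getElem?_append_left hk] at hD'
    rcases h k D' hD' with h | ⟨E, C, hE, hC, hR⟩ | ⟨C, E, hC, hE, hR⟩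
    · exact .inl h
    · exact .inr (.inl ⟨E, C, key' _ _ hE, key' _ _ hC, hR⟩)
    · exact .inr (.inr ⟨C, E, key' _ _ hC, key' _ _ hE, hR⟩)
  · obtain ⟨k, rfl⟩ := Nat.exists_eq_add_of_le hk
    rw [List.getElem?_append_right hk, Nat.add_sub_cancel_left] at hD'
    obtain rfl | k := k
    · simp only [List.getElem?_cons_zero, Option.some.injEq] at hD'
      subst hD'
      rcases hD with h | ⟨E, C, hE, hC, hR⟩ | ⟨C, E, hC, hE, hR⟩
      · exact .inl h
      · exact .inr (.inl ⟨E, C, key _ hE, key _ hC, hR⟩)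
      · exact .inr (.inr ⟨C, E, key _ hC, key _ hE, hR⟩)
    · simp at hD'

theorem Der.exists_valid {D : Wff K o} (h : Der J R D) :
    ∃ S, Valid J R S ∧ S.getLast? = some D := by
  induction h with
  | base h =>
    exact ⟨[] ++ [_], Valid.concat (S := []) (fun k => k.elim0) (.inl h), by simp⟩
  | rule _ _ hR ih ih' =>
    obtain ⟨S, hS, hE⟩ := ih
    obtain ⟨S', hS', hC⟩ := ih'
    refine ⟨(S ++ S') ++ [_], (hS.append hS').concat (.inr (.inl ⟨_, _, ?_, ?_, hR⟩)), by simp⟩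
    · exact List.mem_append_left _ (List.mem_of_getLast? hE)
    · exact List.mem_append_right _ (List.mem_of_getLast? hC)
  | @mp C D _ _ ih ih' =>
    obtain ⟨S, hS, hE⟩ := ih
    obtain ⟨S', hS', hC⟩ := ih'
    refine ⟨(S ++ S') ++ [_], (hS.append hS').concat (.inr (.inr ⟨C, imp C D, ?_, ?_, rfl⟩)),
      List.getLast?_concat⟩
    · exact List.mem_append_left _ (List.mem_of_getLast? hE)
    · exact List.mem_append_right _ (List.mem_of_getLast? hC)

theorem Der.mono {J' : Wff K o → Prop} (hJ : ∀ A, J A → J' A) {D : Wff K o} (h : Der J R D) :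
    Der J' R D := by
  induction h with
  | base h => exact .base (hJ _ h)
  | rule _ _ hR ih ih' => exact .rule ih ih' hR
  | mp _ _ ih ih' => exact .mp ih ih'

end Sequences

/-- The theorems: what has a proof. -/
def Thm (A : Wff K o) : Prop := Der IsAxiom RuleR1 A

/-- What is derivable from `H`. -/
def Prv (H : Set (Wff K o)) (A : Wff K o) : Prop :=
  Der (fun D => D ∈ H ∨ Thm D) (RuleR1From H) A

theorem Proves.prv {H : Set (Wff K o)} {A : Wff K o} (h : Proves H A) : Prv H A := by
  obtain ⟨S₁, S₂, ⟨_, h₁⟩, hA, h₂⟩ := h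
  have h₂' : Valid (fun D => D ∈ H ∨ D ∈ S₁) (RuleR1From H) S₂ := fun k => or_assoc.2 (h₂ k)
  refine (h₂'.der (List.mem_of_getLast? hA)).mono fun D hD => hD.imp_right fun hD => ?_
  exact Valid.der h₁ hD

/-- A derivation uses finitely many theorems, and their proofs concatenate into a single one. -/
theorem Prv.exists_proof {H : Set (Wff K o)} {A : Wff K o} (h : Prv H A) :
    ∃ S₁, Valid IsAxiom RuleR1 S₁ ∧ Der (fun D => D ∈ H ∨ D ∈ S₁) (RuleR1From H) A := by
  induction h with
  | base h =>
    rcases h with h | h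
    · exact ⟨[], fun k => k.elim0, .base (.inl h)⟩
    · obtain ⟨S, hS, hA⟩ := Der.exists_valid h
      exact ⟨S, hS, .base (.inr (List.mem_of_getLast? hA))⟩
  | rule _ _ hR ih ih' =>
    obtain ⟨S, hS, hE⟩ := ih
    obtain ⟨S', hS', hC⟩ := ih'
    exact ⟨S ++ S', hS.append hS', .rule (hE.mono fun D => Or.imp_right (List.mem_append_left _))
      (hC.mono fun D => Or.imp_right (List.mem_append_right _)) hR⟩
  | mp _ _ ih ih' =>
    obtain ⟨S, hS, hE⟩ := ih
    obtain ⟨S', hS', hC⟩ := ih'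
    exact ⟨S ++ S', hS.append hS', .mp (hE.mono fun D => Or.imp_right (List.mem_append_left _))
      (hC.mono fun D => Or.imp_right (List.mem_append_right _))⟩

theorem Prv.proves {H : Set (Wff K o)} {A : Wff K o} (h : Prv H A) : Proves H A := by
  obtain ⟨S₁, h₁, hA⟩ := h.exists_proof
  obtain ⟨S₂, h₂, hl⟩ := hA.exists_valid
  -- The collected proof may be empty, whereas a proof must not be; an instance of A5 is appended.
  have ax : IsAxiom (df 1 (var o 0) : Wff K o) := .a5 o 0 _ (isDef_df (by simp [Occurs]))
  refine ⟨S₁ ++ [_], S₂, ⟨by simp, h₁.concat (.inl ax)⟩, hl, fun k => ?_⟩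
  refine (or_assoc.1 (h₂ k)).imp_right (Or.imp_left (List.mem_append_left _))

/-! ### Provable quasi-equality is a congruence -/

/-- `[A ≃ B]` is a theorem, for some choice of the auxiliary variables. -/
def QEq {α : Ty} (A B : Wff K α) : Prop := ∃ E, IsQuasiEq A B E ∧ Thm E

/-- `[A ↓]` is a theorem, for some choice of the auxiliary variable. -/
def Dfd {α : Ty} (A : Wff K α) : Prop := ∃ D, IsDef A D ∧ Thm D

theorem Thm.ax {A : Wff K o} (h : IsAxiom A) : Thm A := .base h

theorem Thm.mp {A B : Wff K o} (h : Thm (imp A B)) (h' : Thm A) : Thm B := Der.mp h' h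

theorem QEq.thm_of_repl {α : Ty} {A B : Wff K α} (h : QEq A B) {vs : List (Ty × ℕ)}
    {C D : Wff K o} (hR : Repl A B vs C D) (hC : Thm C) : Thm D := by
  obtain ⟨E, hE, hT⟩ := h
  exact .rule hT hC ⟨_, _, _, _, hE, hR⟩

theorem Repl.eq_left {α : Ty} {A B : Wff K α} {vs : List (Ty × ℕ)} {γ : Ty} {C D : Wff K γ}
    (h : Repl A B vs C D) (X : Wff K γ) : Repl A B vs (eq C X) (eq D X) :=
  .appLeft _ (.appRight _ h)

theorem Repl.eq_right {α : Ty} {A B : Wff K α} {vs : List (Ty × ℕ)} {γ : Ty} {C D : Wff K γ}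
    (h : Repl A B vs C D) (X : Wff K γ) : Repl A B vs (eq X C) (eq X D) :=
  .appRight _ h

theorem Repl.df {α : Ty} {A B : Wff K α} {vs : List (Ty × ℕ)} {γ : Ty} {C D : Wff K γ}
    (h : Repl A B vs C D) (m : ℕ) : Repl A B ((γ, m) :: vs) (df m C) (df m D) :=
  .appRight _ (.eq_right (.lam _ _ (.appRight _ (h.eq_right _))) _)

/-- The left side stands twice in a quasi-equality, in its definedness clause and in the equation,
so R1 is applied twice. -/
theorem QEq.qe_left {α : Ty} {A B : Wff K α} (h : QEq A B) {vs : List (Ty × ℕ)} {γ : Ty}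
    {C D : Wff K γ} (hR : Repl A B vs C D) {m k : ℕ} {X : Wff K γ} (hC : Thm (qe m k C X)) :
    Thm (qe m k D X) := by
  refine h.thm_of_repl (.appRight _ (hR.eq_left _)) ?_
  exact h.thm_of_repl (.appLeft _ (.appRight _ (.appLeft _ (.appRight _ (hR.df m))))) hC

theorem QEq.qe_right {α : Ty} {A B : Wff K α} (h : QEq A B) {vs : List (Ty × ℕ)} {γ : Ty}
    {C D : Wff K γ} (hR : Repl A B vs C D) {m k : ℕ} {X : Wff K γ} (hC : Thm (qe m k X C)) :
    Thm (qe m k X D) := by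
  refine h.thm_of_repl (.appRight _ (hR.eq_right _)) ?_
  exact h.thm_of_repl (.appLeft _ (.appRight _ (.appRight _ (hR.df k)))) hC

theorem dfd_var (α : Ty) (n : ℕ) : Dfd (var α n : Wff K α) :=
  ⟨_, isDef_df (not_occurs_of_bd_le le_rfl),
    .ax (.a5 _ _ _ (isDef_df (not_occurs_of_bd_le le_rfl)))⟩

theorem dfd_lam {α : Ty} (β : Ty) (n : ℕ) (A : Wff K α) : Dfd (lam β n A) :=
  ⟨_, isDef_df (not_occurs_of_bd_le le_rfl),
    .ax (.a7 _ _ _ _ (isDef_df (not_occurs_of_bd_le le_rfl)))⟩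

theorem dfd_primitive {α : Ty} {c : Wff K α} (hc : IsPrimitiveConstant c) : Dfd c :=
  ⟨_, isDef_df (not_occurs_of_bd_le le_rfl),
    .ax (.a6 _ _ hc (isDef_df (not_occurs_of_bd_le le_rfl)))⟩

theorem dfd_app {β : Ty} (A : Wff K (arr o β)) (B : Wff K β) : Dfd (app A B) :=
  ⟨_, isDef_df (not_occurs_of_bd_le le_rfl),
    .ax (.a8 _ _ _ (isDef_df (not_occurs_of_bd_le le_rfl)))⟩

/-- A wff of type `o` can only be a variable, a nonlogical constant or an application, and each is
defined by A5, A6 or A8. -/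
theorem dfd_o (A : Wff K o) : Dfd A := by
  cases A with
  | var => exact dfd_var _ _
  | cst => exact dfd_primitive (.cst _)
  | app => exact dfd_app _ _

theorem thm_beta {α β : Ty} {A : Wff K α} (hA : Dfd A) {n : ℕ} {B : Wff K β}
    (h : FreeFor A α n B) {E : Wff K o}
    (hE : IsQuasiEq (app (lam α n B) A) (subst α n A B) E) : Thm E := by
  obtain ⟨D, hD, hT⟩ := hA
  exact Thm.mp (.ax (.a4 n A B D E h hD hE)) hT

theorem QEq.beta {α β : Ty} {A : Wff K α} (hA : Dfd A) {n : ℕ} {B : Wff K β}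
    (h : FreeFor A α n B) : QEq (app (lam α n B) A) (subst α n A B) :=
  have hE := isQuasiEq_qe (not_occurs_of_bd_le le_rfl) (not_occurs_of_bd_le le_rfl)
  ⟨_, hE, thm_beta hA h hE⟩

theorem QEq.beta' {α β : Ty} {A : Wff K α} (hA : Dfd A) {n : ℕ} {B : Wff K β}
    (h : FreeFor A α n B) {C : Wff K β} (hC : subst α n A B = C) :
    QEq (app (lam α n B) A) C := hC ▸ QEq.beta hA h

theorem QEq.beta_self {β : Ty} (α : Ty) (n : ℕ) (B : Wff K β) :
    QEq (app (lam α n B) (var α n)) B :=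
  .beta' (dfd_var _ _) (freeFor_var_self _ _ _) (subst_var_self _ _ _)

/-- The redex `[λ f A] f` contracts to `A`; using this quasi-equality to rewrite its own left side
gives `A ≃ A`. The type `αα` of `f` differs from `α`, so `f` does not interfere with the auxiliary
variables. -/
theorem thm_qe_refl {α : Ty} {A : Wff K α} {m k : ℕ} (hm : ¬ Occurs α m A)
    (hk : ¬ Occurs α k A) : Thm (qe m k A A) := by
  have hE : IsQuasiEq (app (lam (arr α α) 0 A) (var (arr α α) 0)) A
      (qe m k (app (lam (arr α α) 0 A) (var (arr α α) 0)) A) := by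
    refine isQuasiEq_qe ?_ hk
    simp [Occurs, hm, Ty.arr_ne_left]
  have hT : Thm (qe m k (app (lam (arr α α) 0 A) (var (arr α α) 0)) A) :=
    thm_beta (dfd_var _ 0) (freeFor_var_self _ _ A) (by rwa [subst_var_self])
  exact QEq.qe_left ⟨_, hE, hT⟩ .here hT

@[refl] theorem QEq.refl {α : Ty} (A : Wff K α) : QEq A A :=
  have h : ¬ Occurs α (bd A) A := not_occurs_of_bd_le le_rfl
  ⟨_, isQuasiEq_qe h h, thm_qe_refl h h⟩

theorem QEq.repl {α : Ty} {A B : Wff K α} (h : QEq A B) {vs : List (Ty × ℕ)} {γ : Ty}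
    {C D : Wff K γ} (hR : Repl A B vs C D) : QEq C D := by
  have h₁ : ¬ Occurs γ (max (bd C) (bd D)) C := not_occurs_of_bd_le (le_max_left _ _)
  have h₂ : ¬ Occurs γ (max (bd C) (bd D)) D := not_occurs_of_bd_le (le_max_right _ _)
  exact ⟨_, isQuasiEq_qe h₁ h₂, h.qe_right hR (thm_qe_refl h₁ h₁)⟩

theorem QEq.symm {α : Ty} {A B : Wff K α} (h : QEq A B) : QEq B A := by
  have h₁ : ¬ Occurs α (max (bd A) (bd B)) A := not_occurs_of_bd_le (le_max_left _ _)
  have h₂ : ¬ Occurs α (max (bd A) (bd B)) B := not_occurs_of_bd_le (le_max_right _ _)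
  exact ⟨_, isQuasiEq_qe h₂ h₁, h.qe_left .here (thm_qe_refl h₁ h₁)⟩

theorem QEq.trans {α : Ty} {A B C : Wff K α} (h : QEq A B) (h' : QEq B C) : QEq A C := by
  have h₁ : ¬ Occurs α (max (bd A) (bd C)) A := not_occurs_of_bd_le (le_max_left _ _)
  have h₂ : ¬ Occurs α (max (bd A) (bd C)) C := not_occurs_of_bd_le (le_max_right _ _)
  exact ⟨_, isQuasiEq_qe h₁ h₂, h'.qe_right .here (h.qe_right .here (thm_qe_refl h₁ h₁))⟩

instance {α : Ty} : Trans (QEq (K := K) (α := α)) QEq QEq := ⟨QEq.trans⟩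

theorem QEq.thm {A B : Wff K o} (h : QEq A B) (hA : Thm A) : Thm B := h.thm_of_repl .here hA

theorem QEq.app {α β : Ty} {A A' : Wff K (arr α β)} {B B' : Wff K β} (h : QEq A A')
    (h' : QEq B B') : QEq (app A B) (app A' B') :=
  (h.repl (.appLeft B .here)).trans (h'.repl (.appRight A' .here))

theorem QEq.lam {α : Ty} {A A' : Wff K α} (h : QEq A A') (β : Ty) (n : ℕ) :
    QEq (lam β n A) (lam β n A') := h.repl (.lam _ _ .here)

theorem QEq.eq {α : Ty} {A A' B B' : Wff K α} (h : QEq A A') (h' : QEq B B') :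
    QEq (eq A B) (eq A' B') := .app (.app (.refl _) h) h'

theorem QEq.and {A A' B B' : Wff K o} (h : QEq A A') (h' : QEq B B') :
    QEq (and A B) (and A' B') := .app (.app (.refl _) h) h'

theorem QEq.imp {A A' B B' : Wff K o} (h : QEq A A') (h' : QEq B B') :
    QEq (imp A B) (imp A' B') := .app (.app (.refl _) h) h'

theorem QEq.all {A A' : Wff K o} (h : QEq A A') (α : Ty) (n : ℕ) :
    QEq (all α n A) (all α n A') := .eq (.refl _) (h.lam _ _)

theorem QEq.df {α : Ty} {A A' : Wff K α} (h : QEq A A') (m : ℕ) : QEq (df m A) (df m A') :=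
  h.repl (Repl.here.df m)

theorem QEq.qe {α : Ty} {A A' B B' : Wff K α} (h : QEq A A') (h' : QEq B B') (m k : ℕ) :
    QEq (qe m k A B) (qe m k A' B') :=
  .imp (.app (.app (.refl _) (h.df m)) (h'.df k)) (h.eq h')

theorem QEq.subst {α β : Ty} {P R : Wff K β} (h : QEq P R) {A : Wff K α} (hA : Dfd A) {n : ℕ}
    (hP : FreeFor A α n P) (hR : FreeFor A α n R) : QEq (subst α n A P) (subst α n A R) :=
  ((QEq.beta hA hP).symm.trans ((h.lam _ _).app (.refl _))).trans (.beta hA hR)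

/-- This is A11 with both definedness premises discharged. -/
theorem IsQuasiEq.qeq_eq {α : Ty} {A B : Wff K α} {E : Wff K o} (hE : IsQuasiEq A B E)
    (hA : Dfd A) (hB : Dfd B) : QEq E (Wff.eq A B) := by
  obtain ⟨D₁, hD₁, hT₁⟩ := hA
  obtain ⟨D₂, hD₂, hT₂⟩ := hB
  have hG : IsQuasiEq E (Wff.eq A B) _ :=
    isQuasiEq_qe (not_occurs_of_bd_le le_rfl) (not_occurs_of_bd_le le_rfl)
  exact ⟨_, hG, ((Thm.ax (.a11 A B D₁ D₂ E _ hD₁ hD₂ hE hG)).mp hT₁).mp hT₂⟩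

theorem thm_eq_iff {α : Ty} {A B : Wff K α} (hA : Dfd A) (hB : Dfd B) :
    Thm (eq A B) ↔ QEq A B := by
  constructor
  · intro h
    have hE : IsQuasiEq A B _ :=
      isQuasiEq_qe (not_occurs_of_bd_le le_rfl) (not_occurs_of_bd_le le_rfl)
    exact ⟨_, hE, (hE.qeq_eq hA hB).symm.thm h⟩
  · rintro ⟨E, hE, hT⟩
    exact (hE.qeq_eq hA hB).thm hT

theorem thm_tt : Thm (tt : Wff K o) :=
  have h : Dfd (Q o : Wff K _) := dfd_primitive (.Q _)
  (thm_eq_iff h h).2 (.refl _)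

theorem QEq.thm_of_tt {A : Wff K o} (h : QEq A tt) : Thm A := h.symm.thm thm_tt

/-! ### Extensionality, eta and alpha conversion -/

theorem QEq.ext_var_three (α β : Ty) {m k : ℕ} (hm : ¬ (β = α ∧ 3 = m))
    (hk : ¬ (β = α ∧ 3 = k)) :
    QEq (Wff.eq (var (arr α β) 0) (var (arr α β) 1))
      (Wff.all β 3 (Wff.qe m k (Wff.app (var (arr α β) 0) (var β 3))
        (Wff.app (var (arr α β) 1) (var β 3))) : Wff K o) := by
  have l := Ty.arr_ne_left α β
  refine (thm_eq_iff (dfd_o _) (dfd_o _)).1 (.ax (.a3 α β _ (isQuasiEq_qe ?_ ?_)))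
  · simp [vf, vx, Occurs, hm, l]
  · simp [vg, vx, Occurs, hk, l]

/-- Extensionality passes from two variables to defined wffs in which the bound variable is not
free. -/
theorem QEq.ext_of_var {α β : Ty} {n m k : ℕ}
    (h₀ : QEq (Wff.eq (var (arr α β) 0) (var (arr α β) 1))
      (Wff.all β n (Wff.qe m k (Wff.app (var (arr α β) 0) (var β n))
        (Wff.app (var (arr α β) 1) (var β n))) : Wff K o))
    {F G : Wff K (arr α β)} (hF : Dfd F) (hG : Dfd G)
    (hFn : ¬ Free β n F) (hGn : ¬ Free β n G)
    (hFm : ¬ Free α m F) (hFk : ¬ Free α k F) (hGm : ¬ Free α m G) (hGk : ¬ Free α k G) :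
    QEq (Wff.eq F G) (Wff.all β n (Wff.qe m k (Wff.app F (var β n)) (Wff.app G (var β n)))) := by
  have l := Ty.arr_ne_left α β
  have r := Ty.arr_ne_right α β
  -- The variable `g` is first renamed to a fresh `q`, so that the later substitution of `G` does
  -- not touch occurrences of `g` inside `F`.
  obtain ⟨q, hq, hqF⟩ : ∃ q, 1 < q ∧ bd F ≤ q := ⟨bd F + 2, by omega, by omega⟩
  have h₁ : QEq (Wff.eq (var (arr α β) 0) (var (arr α β) q))
      (Wff.all β n (Wff.qe m k (Wff.app (var (arr α β) 0) (var β n))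
        (Wff.app (var (arr α β) q) (var β n))) : Wff K o) := by
    have := h₀.subst (dfd_var (arr α β) q) (n := 1) (by simp)
      (freeFor_all (by simp [r]) (freeFor_qe (by simp [l]) (by simp [l]) (by simp) (by simp)))
    rw [subst_all _ _ _ _ _ (by simp [r.symm]), subst_qe _ _ _ (by simp [l.symm])
      (by simp [l.symm])] at this
    simpa [subst_var_ne, r.symm] using this
  have hq₀ : ¬ (arr α β = arr α β ∧ q = 0) := by omega
  have h₂ : QEq (Wff.eq F (var (arr α β) q))
      (Wff.all β n (Wff.qe m k (Wff.app F (var β n))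
        (Wff.app (var (arr α β) q) (var β n))) : Wff K o) := by
    have := h₁.subst hF (n := 0) (by simp)
      (freeFor_all hFn (freeFor_qe hFm hFk (by simp) (by simp)))
    rw [subst_all _ _ _ _ _ (by simp [r.symm]), subst_qe _ _ _ (by simp [l.symm])
      (by simp [l.symm])] at this
    simpa [subst_var_ne _ _ _ _ hq₀, subst_var_ne, r.symm] using this
  have := h₂.subst hG (n := q) (by simp [freeFor_of_not_free, not_free_of_bd_le hqF])
      (freeFor_all hGn (freeFor_qe hGm hGk
        (by simp [freeFor_of_not_free, not_free_of_bd_le hqF]) (by simp)))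
  rw [subst_all _ _ _ _ _ (by simp [r.symm]), subst_qe _ _ _ (by simp [l.symm])
    (by simp [l.symm])] at this
  simpa [subst_var_ne, r.symm, subst_of_not_free _ (not_free_of_bd_le hqF)] using this

/-- Extensionality applied to the theorem `[λ x A] = [λ x A]` gives `∀ x [A ≃ A]`, which abbreviates
an equation between these two abstractions. -/
theorem QEq.lamy_tt_qe (β : Ty) {α : Ty} {A : Wff K α} {m k : ℕ}
    (hm : ¬ (β = α ∧ 3 = m)) (hk : ¬ (β = α ∧ 3 = k))
    (hAm : ¬ Free α m A) (hAk : ¬ Free α k A) :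
    QEq (lamy β tt) (Wff.lam β 3 (Wff.qe m k A A)) := by
  have hA : QEq (Wff.app (Wff.lam β 3 A) (var β 3)) A := .beta_self _ _ _
  have h := QEq.ext_of_var (.ext_var_three α β hm hk) (dfd_lam β 3 A) (dfd_lam β 3 A)
    (by simp) (by simp)
    (by simp [hAm]) (by simp [hAk]) (by simp [hAm]) (by simp [hAk])
  have h' := (h.trans ((hA.qe hA m k).all _ _)).thm
    ((thm_eq_iff (dfd_lam β 3 A) (dfd_lam β 3 A)).2 (.refl _))
  exact (thm_eq_iff (dfd_lam _ _ _) (dfd_lam _ _ _)).1 h'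

theorem QEq.app_lamy_tt {β : Ty} {A : Wff K β} (hA : Dfd A) :
    QEq (Wff.app (lamy β tt) A) tt := .beta' hA (by simp) (by simp)

theorem QEq.qe_tt {α : Ty} {A : Wff K α} {m k : ℕ}
    (hAm : ¬ Free α m A) (hAk : ¬ Free α k A) : QEq (Wff.qe m k A A) tt := by
  -- The bound variable has type `αα`, so it cannot be an auxiliary variable of type `α`. Applying
  -- both abstractions to it leaves `T` and `A ≃ A`.
  have h := QEq.lamy_tt_qe (arr α α) (m := m) (k := k) (by simp [Ty.arr_ne_left])
    (by simp [Ty.arr_ne_left]) hAm hAk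
  exact (QEq.beta_self _ _ _).symm.trans
    ((h.symm.app (.refl _)).trans (.app_lamy_tt (dfd_var _ _)))

theorem QEq.eq_tt {α : Ty} {A : Wff K α} (hA : Dfd A) : QEq (Wff.eq A A) tt := by
  have h : ¬ Occurs α (bd A) A := not_occurs_of_bd_le le_rfl
  have h' : ¬ Free α (bd A) A := not_free_of_bd_le le_rfl
  exact ((isQuasiEq_qe h h).qeq_eq hA hA).symm.trans (.qe_tt h' h')

theorem QEq.of_eq_tt {α : Ty} {A B : Wff K α} (hA : Dfd A) (hB : Dfd B)
    (h : QEq (Wff.eq A B) tt) : QEq A B := (thm_eq_iff hA hB).1 h.thm_of_tt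

/-- An instance of alpha conversion needed before the general rule, which rests on eta and thereby
on this. Both sides are compared with `λ x [T ≃ T]`. -/
theorem QEq.lam_three_tt (β : Ty) : QEq (Wff.lam β 3 (tt : Wff K o)) (lamy β tt) := by
  have h : ∀ m, ¬ Free o m (tt : Wff K o) := by simp
  exact ((QEq.qe_tt (h 4) (h 4)).lam _ _).symm.trans
    (QEq.lamy_tt_qe β (by simp) (by simp) (h 4) (h 4)).symm

theorem QEq.eta_var (α β : Ty) (p n : ℕ) :
    QEq (var (arr α β) p : Wff K _) (Wff.lam β n (Wff.app (var (arr α β) p) (var β n))) := by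
  have l := Ty.arr_ne_left α β
  have r := Ty.arr_ne_right α β
  have hb : QEq (Wff.app (Wff.lam β n (Wff.app (var (arr α β) p) (var β n))) (var β 3))
      (Wff.app (var (arr α β) p : Wff K _) (var β 3)) :=
    .beta' (dfd_var _ _) (by simp) (by simp [subst_var_ne, r])
  refine .of_eq_tt (dfd_var _ _) (dfd_lam _ _ _) ?_
  have h := QEq.ext_of_var (K := K) (.ext_var_three α β (m := n + 4) (k := n + 4) (by omega) (by omega))
    (dfd_var (arr α β) p) (dfd_lam β n (Wff.app (var (arr α β) p) (var β n)))
    (by simp [r]) (by simp [r])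
    (by simp [l]) (by simp [l]) (by simp [l]) (by simp [l])
  refine h.trans ((((QEq.refl _).qe hb _ _).all _ _).trans ?_)
  refine (QEq.all (.qe_tt ?_ ?_) _ _).trans ((QEq.eq (.refl _) (.lam_three_tt _)).trans
    (.eq_tt (dfd_lam _ _ _))) <;> simp [l]

theorem QEq.eta {α β : Ty} {F : Wff K (arr α β)} (hF : Dfd F) {n : ℕ} (hn : ¬ Free β n F) :
    QEq F (Wff.lam β n (Wff.app F (var β n))) := by
  have h := (QEq.eta_var α β 0 n).subst hF (n := 0) (by simp) (freeFor_lam hn (by simp))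
  rw [subst_lam _ _ _ _ _ (by simp [(Ty.arr_ne_right α β).symm])] at h
  simpa [subst_var_ne, (Ty.arr_ne_right α β).symm] using h

/-- Eta-expand the abstraction with the new variable, then contract the inner redex. -/
theorem QEq.alpha {α β : Ty} {A : Wff K α} {n k : ℕ} (hk : ¬ Free β k (Wff.lam β n A))
    (h : FreeFor (var β k) β n A) :
    QEq (Wff.lam β n A) (Wff.lam β k (Wff.subst β n (var β k) A)) :=
  (QEq.eta (dfd_lam β n A) hk).trans (.lam (.beta (dfd_var _ _) h) _ _)

/-- Extensionality for defined wffs. -/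
theorem QEq.ext {α β : Ty} {F G : Wff K (arr α β)} (hF : Dfd F) (hG : Dfd G) {n m k : ℕ}
    (hFn : ¬ Free β n F) (hGn : ¬ Free β n G) (hnm : n ≠ m) (hnk : n ≠ k)
    (hm : m ≠ 3) (hk : k ≠ 3)
    (hFm : ¬ Free α m F) (hFk : ¬ Free α k F) (hGm : ¬ Free α m G) (hGk : ¬ Free α k G) :
    QEq (Wff.eq F G) (Wff.all β n (Wff.qe m k (Wff.app F (var β n)) (Wff.app G (var β n)))) := by
  have l := Ty.arr_ne_left α β
  have r := Ty.arr_ne_right α β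
  refine .ext_of_var ?_ hF hG hFn hGn hFm hFk hGm hGk
  refine (QEq.ext_var_three α β (fun h => hm h.2.symm) (fun h => hk h.2.symm)).trans
    (.eq (.refl _) ?_)
  have h := QEq.alpha (K := K) (n := 3) (k := n) (β := β)
    (A := Wff.qe m k (Wff.app (var (arr α β) 0) (var β 3)) (Wff.app (var (arr α β) 1) (var β 3)))
    (by simp [Wff.qe, Wff.df, ex, r]; tauto)
    (freeFor_qe (by simp [hnm]) (by simp [hnk]) (by simp) (by simp))
  rw [subst_qe _ _ _ (by simp [hm]) (by simp [hk])] at h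
  simpa [subst_var_ne, r] using h

theorem QEq.lam_tt (β : Ty) (n : ℕ) : QEq (Wff.lam β n (tt : Wff K o)) (lamy β tt) := by
  have h := QEq.alpha (K := K) (A := tt) (β := β) (n := n) (k := 4) (by simp) (by simp)
  rwa [subst_tt] at h

theorem QEq.all_tt (β : Ty) (n : ℕ) : QEq (Wff.all β n (tt : Wff K o)) tt :=
  (QEq.eq (.refl _) (.lam_tt _ _)).trans (.eq_tt (dfd_lam _ _ _))

theorem QEq.df_alpha {α : Ty} {A : Wff K α} {m k : ℕ} (hm : ¬ Free α m A) (hk : ¬ Free α k A) :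
    QEq (Wff.df m A) (Wff.df k A) := by
  have h := QEq.alpha (A := neg (Wff.eq (var α m) A)) (β := α) (n := m) (k := k)
    (by simp [hk]) (by simp [freeFor_of_not_free, hm])
  simp only [subst_neg, subst_eq, subst_var_eq, subst_of_not_free _ hm] at h
  exact .app (.refl _) (.eq (.refl _) h)

/-- The choice of auxiliary variables is immaterial, by alpha conversion in the definedness clauses.
-/
theorem IsQuasiEq.qeq {α : Ty} {A B : Wff K α} {E E' : Wff K o} (h : IsQuasiEq A B E)
    (h' : IsQuasiEq A B E') : QEq E E' := by
  obtain ⟨m, k, hm, hk, rfl⟩ := isQuasiEq_iff.1 h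
  obtain ⟨m', k', hm', hk', rfl⟩ := isQuasiEq_iff.1 h'
  exact .imp (.app (.app (.refl _) (.df_alpha (mt Free.occurs hm) (mt Free.occurs hm')))
    (.df_alpha (mt Free.occurs hk) (mt Free.occurs hk'))) (.refl _)

/-! ### Truth values and reasoning by cases -/

/-- In A1 the quantified side is `[λ y T] = [λ x [g x]]`, and eta contracts `λ x [g x]` to `g`. -/
theorem QEq.truth_values {G : Wff K (arr o o)} (hG : Dfd G) :
    QEq (Wff.and (Wff.app G tt) (Wff.app G ff)) (Wff.eq (lamy o tt) G) := by
  have h : QEq (Wff.and (Wff.app (var (arr o o) 1) tt) (Wff.app (var (arr o o) 1) ff))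
      (Wff.eq (lamy o tt) (var (arr o o) 1) : Wff K o) :=
    ((thm_eq_iff (dfd_o _) (dfd_o _)).1 (.ax .a1)).trans
      (.eq (.refl _) (QEq.eta_var o o 1 3).symm)
  simpa [subst_of_not_free] using h.subst hG (n := 1) (by simp) (by simp [freeFor_of_not_free])

theorem QEq.tt_and_tt : QEq (Wff.and tt tt : Wff K o) tt :=
  (QEq.and (.symm (.app_lamy_tt (dfd_o _))) (.symm (.app_lamy_tt (dfd_o _)))).trans
    ((QEq.truth_values (dfd_lam _ _ _)).trans (.eq_tt (dfd_lam _ _ _)))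

/-- Take the identity for `G` in `QEq.truth_values`: the right side becomes `F` up to a bound
variable. -/
theorem QEq.tt_and_ff : QEq (Wff.and tt ff : Wff K o) ff := by
  have h : ∀ A : Wff K o, QEq (Wff.app (lamx o (vx o)) A) A :=
    fun A => .beta' (dfd_o A) (by simp [vx]) (by simp [vx])
  exact ((h tt).and (h ff)).symm.trans ((QEq.truth_values (dfd_lam _ _ _)).trans
    (.eq (QEq.lam_tt o 3).symm (.refl _)))

/-- If `P` is `T` at both truth values, A1 makes `λ x P` equal to `λ y T`; applying both to `x`
gives the claim. -/
theorem QEq.tt_of_cases {P : Wff K o} {n : ℕ} (h₁ : QEq (Wff.subst o n tt P) tt)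
    (h₂ : QEq (Wff.subst o n ff P) tt) : QEq P tt := by
  have hT : QEq (Wff.app (Wff.lam o n P) tt) tt :=
    (QEq.beta (dfd_o _) (freeFor_of_closed (by simp) _)).trans h₁
  have hF : QEq (Wff.app (Wff.lam o n P) ff) tt :=
    (QEq.beta (dfd_o _) (freeFor_of_closed (by simp) _)).trans h₂
  have h : QEq (lamy o tt) (Wff.lam o n P) :=
    (thm_eq_iff (dfd_lam _ _ _) (dfd_lam _ _ _)).1
      ((QEq.truth_values (dfd_lam _ _ _)).symm.trans ((hT.and hF).trans .tt_and_tt)).thm_of_tt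
  exact ((h.app (.refl (var o n))).trans (.beta_self _ _ _)).symm.trans
    (.app_lamy_tt (dfd_var _ _))

/-- Two wffs of type `o` that agree at both truth values agree at every wff of type `o`. -/
theorem QEq.of_cases {P R : Wff K o} (n : ℕ) (h₁ : QEq (Wff.subst o n tt P) (Wff.subst o n tt R))
    (h₂ : QEq (Wff.subst o n ff P) (Wff.subst o n ff R)) (A : Wff K o) (hP : FreeFor A o n P)
    (hR : FreeFor A o n R) : QEq (Wff.subst o n A P) (Wff.subst o n A R) := by
  refine QEq.subst (.of_eq_tt (dfd_o _) (dfd_o _) (.tt_of_cases (n := n) ?_ ?_)) (dfd_o _) hP hR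
  · exact (h₁.eq (.refl _)).trans (.eq_tt (dfd_o _))
  · exact (h₂.eq (.refl _)).trans (.eq_tt (dfd_o _))

theorem QEq.tt_and (A : Wff K o) : QEq (Wff.and tt A) A := by
  simpa using QEq.of_cases (P := Wff.and tt (var o 0)) (R := var o 0) 0 (by simpa using .tt_and_tt)
    (by simpa using .tt_and_ff) A (by simp) (by simp)

/-- Both sides are quasi-equal to `∀ x [T = x]`: the left by A1 applied to `λ x [T = x]`, the right
by extensionality, since `F` is `[λ x T] = [λ x x]`. -/
theorem QEq.tt_eq_ff : QEq (Wff.eq tt ff : Wff K o) ff := by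
  have h : ∀ A : Wff K o, QEq (Wff.app (Wff.lam o 3 (Wff.eq tt (var o 3))) A) (Wff.eq tt A) :=
    fun A => .beta' (dfd_o A) (by simp) (by simp)
  have h₁ : QEq (Wff.eq tt ff : Wff K o) (Wff.all o 3 (Wff.eq tt (var o 3))) :=
    (((((h tt).and (h ff)).trans (((QEq.eq_tt (dfd_o _)).and (.refl _)).trans (.tt_and _)))).symm.trans
      (QEq.truth_values (dfd_lam _ _ _)))
  have hx : ∀ A : Wff K o, QEq (Wff.app (lamx o A) (var o 3)) A := fun A => .beta_self _ _ _
  have h₂ : QEq (ff : Wff K o) (Wff.all o 3 (Wff.qe 4 4 tt (var o 3))) :=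
    (QEq.ext_of_var (K := K) (F := lamx o tt) (G := lamx o (vx o)) (m := 4) (k := 4)
      (.ext_var_three _ _ (by simp) (by simp))
      (dfd_lam _ _ _) (dfd_lam _ _ _) (by simp [lamx]) (by simp [lamx])
      (by simp [lamx]) (by simp [lamx]) (by simp [lamx, vx]) (by simp [lamx, vx])).trans
      (.all (.qe (hx _) (hx _) _ _) _ _)
  have h₃ : IsQuasiEq (tt : Wff K o) (var o 3) (Wff.qe 4 4 tt (var o 3)) :=
    isQuasiEq_qe (by simp [tt, Wff.eq, Occurs]) (by simp [Occurs])
  exact h₁.trans (h₂.trans ((h₃.qeq_eq (dfd_o _) (dfd_o _)).all _ _)).symm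

theorem QEq.tt_eq (A : Wff K o) : QEq (Wff.eq tt A) A := by
  simpa using QEq.of_cases (P := Wff.eq tt (var o 0)) (R := var o 0) 0
    (by simpa using .eq_tt (dfd_o _)) (by simpa using .tt_eq_ff) A (by simp) (by simp)

theorem Thm.qeq_tt {A : Wff K o} (h : Thm A) : QEq A tt :=
  ((thm_eq_iff (dfd_o _) (dfd_o _)).1 ((QEq.tt_eq A).symm.thm h)).symm

theorem Thm.subst {P : Wff K o} (h : Thm P) {α : Ty} {A : Wff K α} (hA : Dfd A) {n : ℕ}
    (hP : FreeFor A α n P) : Thm (Wff.subst α n A P) := by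
  have := h.qeq_tt.subst hA hP (by simp)
  rw [subst_tt] at this
  exact this.thm_of_tt

/-! ### Leibniz' law and implication -/

theorem thm_leibniz {α : Ty} {A B : Wff K α} {C : Wff K (arr o α)} (hA : Dfd A) (hB : Dfd B)
    (hC : Dfd C) : Thm (imp (eq A B) (eq (app C A) (app C B))) := by
  have r := Ty.arr_ne_right o α
  -- The substitutions in A2 are made one at a time. Fresh variables of index `q`, one of type `α`
  -- and one of type `oα`, hold the places of `B` and `C` meanwhile.
  obtain ⟨q, hq, hqA, hqB⟩ : ∃ q, 4 < q ∧ bd A ≤ q ∧ bd B ≤ q :=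
    ⟨bd A + bd B + 5, by omega, by omega, by omega⟩
  have nA := fun β => not_free_of_bd_le (β := β) hqA
  have nB := fun β => not_free_of_bd_le (β := β) hqB
  have hq₃ : ¬ (α = α ∧ q = 3) := by omega
  have h₀ : Thm (imp (eq (var α 3) (var α 4)) (eq (app (var (arr o α) 2) (var α 3))
      (app (var (arr o α) 2) (var α 4))) : Wff K o) := .ax (.a2 α)
  have h₁ := h₀.subst (dfd_var (arr o α) q) (n := 2) (by simp)
  simp only [subst_imp, subst_eq, subst_app, subst_var_eq,
    subst_var_ne (arr o α) 2 _ _ (fun h => r h.1.symm)] at h₁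
  have h₂ := h₁.subst (dfd_var α q) (n := 4) (by simp)
  simp only [subst_imp, subst_eq, subst_app, subst_var_eq,
    subst_var_ne α 4 _ _ (fun h => r h.1), subst_var_ne α 4 _ 3 (by simp)] at h₂
  have h₃ := h₂.subst hA (n := 3) (by simp)
  simp only [subst_imp, subst_eq, subst_app, subst_var_eq,
    subst_var_ne α 3 _ _ (fun h => r h.1), subst_var_ne α 3 _ q hq₃] at h₃
  have h₄ := h₃.subst hB (n := q) (by simp [freeFor_of_not_free, nA])
  simp only [subst_imp, subst_eq, subst_app, subst_var_eq,
    subst_var_ne α q _ _ (fun h => r h.1), subst_of_not_free _ (nA _)] at h₄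
  have h₅ := h₄.subst hC (n := q) (by simp [freeFor_of_not_free, nA, nB])
  simpa [subst_of_not_free _ (nA _), subst_of_not_free _ (nB _)] using h₅

/-- Universal instantiation. -/
theorem thm_all_imp_subst {α : Ty} {A : Wff K α} (hA : Dfd A) (n : ℕ) {P : Wff K o}
    (h : FreeFor A α n P) : Thm (imp (all α n P) (Wff.subst α n A P)) := by
  have nA : ¬ Free (arr o α) (bd A) A := not_free_of_bd_le le_rfl
  have hb : ∀ F : Wff K (arr o α), Dfd F →
      QEq (app (lam (arr o α) (bd A) (app (var (arr o α) (bd A)) A)) F) (app F A) :=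
    fun F hF => .beta' hF (by simp [freeFor_of_not_free, nA]) (by simp [subst_of_not_free _ nA])
  -- Leibniz' law for evaluation at `A`, the predicate `λ f [f A]`, applied to the equation `[λ y T]
  -- = [λ x P]` that `∀ x P` abbreviates.
  have h₁ := thm_leibniz (dfd_lam α 4 tt) (dfd_lam α n P)
    (dfd_lam (arr o α) (bd A) (app (var (arr o α) (bd A)) A))
  refine (QEq.imp (.refl _) ((QEq.eq ((hb _ (dfd_lam _ _ _)).trans (.app_lamy_tt hA))
    (hb _ (dfd_lam _ _ _))).trans ((QEq.tt_eq _).trans (.beta hA h)))).thm h₁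

theorem thm_all_imp (α : Ty) (n : ℕ) (P : Wff K o) : Thm (imp (all α n P) P) := by
  simpa [subst_var_self] using thm_all_imp_subst (dfd_var α n) n (freeFor_var_self α n P)

/-- Up to a bound variable `F` is `∀ x x`, which can be instantiated to any `A`. -/
theorem QEq.ff_imp (A : Wff K o) : QEq (Wff.imp ff A) tt := by
  have h := thm_all_imp_subst (dfd_o A) 3 (P := var o 3) (by simp)
  rw [subst_var_eq] at h
  exact (QEq.imp (.eq (.lam_tt o 3) (.refl _)) (.refl _)).trans h.qeq_tt

/-- Unfolding gives `T = [T ∧ A]`. As `T` is closed and is substituted first, neither contraction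
captures a variable. -/
theorem QEq.tt_imp (A : Wff K o) : QEq (Wff.imp tt A) A := by
  have h₁ : QEq (Wff.app impC tt) (lamy o (Wff.eq tt (Wff.and tt (vy o))) : Wff K _) := by
    refine .beta' (dfd_o _) (freeFor_of_closed (by simp) _) ?_
    rw [lamy, subst_lam _ _ _ _ _ (by simp)]
    simp [vx, vy, lamy, subst_var_ne]
  have h₂ : QEq (Wff.app (lamy o (Wff.eq tt (Wff.and tt (vy o)))) A)
      (Wff.eq tt (Wff.and tt A)) :=
    .beta' (dfd_o _) (by simp [vy]) (by simp [vy])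
  exact (h₁.app (.refl A)).trans (h₂.trans ((QEq.tt_eq _).trans (.tt_and _)))

/-! ### Some tautologies -/

theorem QEq.imp_tt (A : Wff K o) : QEq (Wff.imp A tt) tt := by
  simpa using QEq.of_cases (P := Wff.imp (var o 0) tt) (R := tt) 0 (by simpa using .tt_imp _)
    (by simpa using .ff_imp _) A (by simp) (by simp)

theorem QEq.imp_self (A : Wff K o) : QEq (Wff.imp A A) tt := by
  simpa using QEq.of_cases (P := Wff.imp (var o 0) (var o 0)) (R := tt) 0
    (by simpa using .tt_imp _) (by simpa using .ff_imp _) A (by simp) (by simp)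

theorem thm_imp_imp_left (A B : Wff K o) : Thm (imp A (imp B A)) := by
  have nB : ¬ Free o (bd B) B := not_free_of_bd_le le_rfl
  have h := QEq.of_cases (P := imp (var o (bd B)) (imp B (var o (bd B)))) (R := tt) (bd B)
    (by simpa [subst_of_not_free _ nB] using (QEq.tt_imp _).trans (.imp_tt _))
    (by simpa [subst_of_not_free _ nB] using .ff_imp _) A
    (by simp [freeFor_of_not_free, nB]) (by simp)
  simp only [subst_imp, subst_var_eq, subst_tt, subst_of_not_free _ nB] at h
  exact h.thm_of_tt

/-- Cases on `A` alone suffice: at `T` both sides reduce to `B ⊃ C`, and at `F` the final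
implication is `T`. -/
theorem thm_imp_distrib (A B C : Wff K o) :
    Thm (imp (imp A (imp B C)) (imp (imp A B) (imp A C))) := by
  obtain ⟨q, hqB, hqC⟩ : ∃ q, bd B ≤ q ∧ bd C ≤ q := ⟨bd B + bd C, by omega, by omega⟩
  have nB : ¬ Free o q B := not_free_of_bd_le hqB
  have nC : ¬ Free o q C := not_free_of_bd_le hqC
  have h := QEq.of_cases (R := tt) (P := imp (imp (var o q) (imp B C))
    (imp (imp (var o q) B) (imp (var o q) C))) q
    (by
      simp only [subst_imp, subst_var_eq, subst_tt, subst_of_not_free _ nB,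
        subst_of_not_free _ nC]
      exact (QEq.imp (.tt_imp _) (.imp (.tt_imp _) (.tt_imp _))).trans (.imp_self _))
    (by
      simp only [subst_imp, subst_var_eq, subst_tt, subst_of_not_free _ nB,
        subst_of_not_free _ nC]
      exact (QEq.imp (.refl _) (.imp (.refl _) (.ff_imp _))).trans
        ((QEq.imp (.refl _) (.imp_tt _)).trans (.imp_tt _)))
    A (by simp [freeFor_of_not_free, nB, nC]) (by simp)
  simp only [subst_imp, subst_var_eq, subst_tt, subst_of_not_free _ nB,
    subst_of_not_free _ nC] at h
  exact h.thm_of_tt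

theorem thm_eq_imp (A B : Wff K o) : Thm (imp (eq A B) (imp A B)) := by
  have nB : ¬ Free o (bd B) B := not_free_of_bd_le le_rfl
  have h := QEq.of_cases (P := imp (eq (var o (bd B)) B) (imp (var o (bd B)) B)) (R := tt) (bd B)
    (by
      simp only [subst_imp, subst_eq, subst_var_eq, subst_tt, subst_of_not_free _ nB]
      exact (QEq.imp (.tt_eq _) (.tt_imp _)).trans (.imp_self _))
    (by
      simp only [subst_imp, subst_eq, subst_var_eq, subst_tt, subst_of_not_free _ nB]
      exact (QEq.imp (.refl _) (.ff_imp _)).trans (.imp_tt _)) A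
    (by simp [freeFor_of_not_free, nB]) (by simp)
  simp only [subst_imp, subst_eq, subst_var_eq, subst_tt, subst_of_not_free _ nB] at h
  exact h.thm_of_tt

theorem Thm.imp_intro {B : Wff K o} (h : Thm B) (A : Wff K o) : Thm (imp A B) :=
  (thm_imp_imp_left B A).mp h

theorem Thm.imp_trans {A B C : Wff K o} (h : Thm (imp A B)) (h' : Thm (imp B C)) :
    Thm (imp A C) :=
  ((thm_imp_distrib A B C).mp (h'.imp_intro A)).mp h

/-- Cases on a fresh variable in place of `A`: at `T` both sides are `∀ x P`, at `F` both are `T`.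
That `x` is not free in `A` allows `A` to be put back under the quantifier. -/
theorem QEq.all_imp {α : Ty} {n : ℕ} {A : Wff K o} (hA : ¬ Free α n A) (P : Wff K o) :
    QEq (Wff.all α n (Wff.imp A P)) (Wff.imp A (Wff.all α n P)) := by
  obtain ⟨q, hqn, hqP⟩ : ∃ q, n < q ∧ bd P ≤ q := ⟨n + bd P + 1, by omega, by omega⟩
  have nP : ¬ Free o q P := not_free_of_bd_le hqP
  have nq : ¬ (α = o ∧ n = q) := by omega
  have key : ∀ B : Wff K o, Wff.subst o q B (Wff.all α n (Wff.imp (var o q) P)) =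
      Wff.all α n (Wff.imp B P) := fun B => by
    simp [subst_all _ _ _ _ _ nq, subst_of_not_free _ nP]
  have key' : ∀ B : Wff K o, Wff.subst o q B (Wff.imp (var o q) (Wff.all α n P)) =
      Wff.imp B (Wff.all α n P) := fun B => by
    simp [subst_all _ _ _ _ _ nq, subst_of_not_free _ nP]
  have h := QEq.of_cases (P := Wff.all α n (Wff.imp (var o q) P))
    (R := Wff.imp (var o q) (Wff.all α n P)) q
    (by
      rw [key, key']
      exact ((QEq.tt_imp _).all _ _).trans (QEq.tt_imp _).symm)
    (by
      rw [key, key']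
      exact ((QEq.ff_imp _).all _ _).trans ((QEq.all_tt _ _).trans (QEq.ff_imp _).symm))
    A (freeFor_all hA (by simp [freeFor_of_not_free, nP]))
    (by simp [freeFor_of_not_free, nP, nq])
  rwa [key, key'] at h

theorem Thm.imp_all {A P : Wff K o} (h : Thm (imp A P)) {α : Ty} {n : ℕ} (hA : ¬ Free α n A) :
    Thm (imp A (all α n P)) :=
  (QEq.all_imp hA P).thm ((h.qeq_tt.all _ _).trans (.all_tt _ _)).thm_of_tt

/-! ### Replacement under a hypothesis -/

/-- Neither `A` nor `B` has to be defined, since extensionality is applied to the abstractions,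
which always are. -/
theorem QEq.ext_lam {α : Ty} (β : Ty) (n : ℕ) {A B : Wff K α} {E : Wff K o}
    (hE : IsQuasiEq A B E) :
    QEq (Wff.eq (Wff.lam β n A) (Wff.lam β n B)) (Wff.all β n E) := by
  obtain ⟨q, hn, hA, hB⟩ : ∃ q, n + 3 < q ∧ bd A ≤ q ∧ bd B ≤ q :=
    ⟨bd A + bd B + n + 4, by omega, by omega, by omega⟩
  have nA : ¬ Occurs α q A := not_occurs_of_bd_le hA
  have nB : ¬ Occurs α q B := not_occurs_of_bd_le hB
  have nA' : ¬ Free α q A := mt Free.occurs nA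
  have nB' : ¬ Free α q B := mt Free.occurs nB
  have h := QEq.ext (dfd_lam β n A) (dfd_lam β n B) (n := n) (m := q) (k := q) (by simp)
    (by simp) (by omega) (by omega) (by omega) (by omega) (by simp [nA']) (by simp [nA'])
    (by simp [nB']) (by simp [nB'])
  exact h.trans (.all ((QEq.qe (.beta_self _ _ _) (.beta_self _ _ _) _ _).trans
    ((isQuasiEq_qe nA nB).qeq hE)) _ _)

/-- Provably equal wffs may be substituted in quasi-equations, under a hypothesis. -/
theorem thm_imp_subst {δ γ : Ty} {X E : Wff K o} {F F' : Wff K δ} {u : ℕ} {G B B' : Wff K γ}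
    (hF : Dfd F) (hF' : Dfd F') (hX : Thm (imp X (eq F F')))
    (hG : FreeFor F δ u G) (hG' : FreeFor F' δ u G) (hB : QEq (Wff.subst δ u F G) B)
    (hB' : QEq (Wff.subst δ u F' G) B') (hu : ¬ Free δ u B) (hE : IsQuasiEq B B' E) :
    Thm (imp X E) := by
  obtain ⟨q, hqu, hqF, hqF', hqB, hqB'⟩ :
      ∃ q, u < q ∧ bd F ≤ q ∧ bd F' ≤ q ∧ bd B ≤ q ∧ bd B' ≤ q :=
    ⟨u + bd F + bd F' + bd B + bd B' + 1, by omega, by omega, by omega, by omega, by omega⟩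
  have nF : ¬ Free γ q F := not_free_of_bd_le hqF
  have nF' : ¬ Free γ q F' := not_free_of_bd_le hqF'
  have nB : ¬ Free γ q B := not_free_of_bd_le hqB
  have nu : ¬ (γ = δ ∧ q = u) := by omega
  -- Leibniz' law is used with the predicate `λ u [B ≃ G]`, which is `T` at `F` and `E` at `F'`.
  have h₁ : QEq (app (lam δ u (qe q q B G)) F) tt := by
    refine (QEq.beta' hF (freeFor_qe nF nF (freeFor_of_not_free _ hu) hG)
      (subst_qe _ _ _ nu nu)).trans ?_
    rw [subst_of_not_free _ hu]
    exact (QEq.qe (.refl _) hB _ _).trans (.qe_tt nB nB)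
  have h₂ : QEq (app (lam δ u (qe q q B G)) F') E := by
    refine (QEq.beta' hF' (freeFor_qe nF' nF' (freeFor_of_not_free _ hu) hG')
      (subst_qe _ _ _ nu nu)).trans ?_
    rw [subst_of_not_free _ hu]
    exact (QEq.qe (.refl _) hB' _ _).trans
      ((isQuasiEq_qe (not_occurs_of_bd_le hqB) (not_occurs_of_bd_le hqB')).qeq hE)
  exact hX.imp_trans ((QEq.imp (.refl _) ((h₁.eq h₂).trans (.tt_eq _))).thm
    (thm_leibniz hF hF' (dfd_lam δ u (qe q q B G))))

theorem thm_imp_eq_lam {α : Ty} {X E : Wff K o} {C D : Wff K α} (hE : IsQuasiEq C D E)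
    (hX : Thm (imp X E)) {β : Ty} {n : ℕ} (hn : ¬ Free β n X) :
    Thm (imp X (eq (lam β n C) (lam β n D))) :=
  (QEq.imp (.refl _) (QEq.ext_lam β n hE).symm).thm (hX.imp_all hn)

theorem exists_isQuasiEq {α : Ty} (A B : Wff K α) : ∃ E, IsQuasiEq A B E :=
  ⟨_, isQuasiEq_qe (not_occurs_of_bd_le le_rfl) (not_occurs_of_bd_le le_rfl)⟩

/-- `C` and `D` may be undefined, so `λ z C` and `λ z D` with a vacuous `z` of type `o` are
substituted for `u` in the context `u z e`, and beta restores `C e` and `D e`. Generalizing over `z`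
is allowed because it is not free in `X`. -/
theorem thm_imp_app_left {γ δ : Ty} {X E E' : Wff K o} {C D : Wff K (arr γ δ)} (e : Wff K δ)
    (hE : IsQuasiEq C D E) (hX : Thm (imp X E)) (hE' : IsQuasiEq (app C e) (app D e) E') :
    Thm (imp X E') := by
  obtain ⟨z, hzX, hzC, hzD, hze⟩ : ∃ z, bd X ≤ z ∧ bd C ≤ z ∧ bd D ≤ z ∧ bd e ≤ z :=
    ⟨bd X + bd C + bd D + bd e, by omega, by omega, by omega, by omega⟩
  have ne : ∀ β, ¬ Free β z e := fun β => not_free_of_bd_le hze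
  have h : ∀ C' : Wff K (arr γ δ), QEq (Wff.subst (arr (arr γ δ) o) z (lam o z C')
      (app (app (var _ z) (var o z)) e)) (app C' e) := fun C' => by
    simpa [subst_of_not_free _ (ne _), subst_var_ne] using
      (QEq.beta_self o z C').app (.refl e)
  exact thm_imp_subst (dfd_lam _ _ _) (dfd_lam _ _ _)
    (thm_imp_eq_lam hE hX (β := o) (n := z) (not_free_of_bd_le hzX))
    (by simp [freeFor_of_not_free, ne]) (by simp [freeFor_of_not_free, ne]) (h C) (h D)
    (by simp [ne, not_free_of_bd_le hzC]) hE'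

theorem thm_imp_app_right {γ δ : Ty} {X E E' : Wff K o} {C D : Wff K δ} (e : Wff K (arr γ δ))
    (hE : IsQuasiEq C D E) (hX : Thm (imp X E)) (hE' : IsQuasiEq (app e C) (app e D) E') :
    Thm (imp X E') := by
  obtain ⟨z, hzX, hzC, hzD, hze⟩ : ∃ z, bd X ≤ z ∧ bd C ≤ z ∧ bd D ≤ z ∧ bd e ≤ z :=
    ⟨bd X + bd C + bd D + bd e, by omega, by omega, by omega, by omega⟩
  have ne : ∀ β, ¬ Free β z e := fun β => not_free_of_bd_le hze
  have h : ∀ C' : Wff K δ, QEq (Wff.subst (arr δ o) z (lam o z C')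
      (app e (app (var _ z) (var o z)))) (app e C') := fun C' => by
    simpa [subst_of_not_free _ (ne _), subst_var_ne] using
      QEq.app (.refl e) (QEq.beta_self o z C')
  exact thm_imp_subst (dfd_lam _ _ _) (dfd_lam _ _ _)
    (thm_imp_eq_lam hE hX (β := o) (n := z) (not_free_of_bd_le hzX))
    (by simp [freeFor_of_not_free, ne]) (by simp [freeFor_of_not_free, ne]) (h C) (h D)
    (by simp [ne, not_free_of_bd_le hzC]) hE'

theorem thm_imp_repl {α : Ty} {A B : Wff K α} {E X : Wff K o} (hE : IsQuasiEq A B E)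
    (hX : Thm (imp X E)) {vs : List (Ty × ℕ)} {γ : Ty} {C D : Wff K γ} (hR : Repl A B vs C D)
    (hvs : ∀ v ∈ vs, ¬ Free v.1 v.2 X) {E' : Wff K o} (hE' : IsQuasiEq C D E') :
    Thm (imp X E') := by
  induction hR generalizing E' with
  | here => exact (QEq.imp (.refl _) (hE.qeq hE')).thm hX
  | @appLeft _ _ _ C D e _ ih =>
    obtain ⟨E₁, h₁⟩ := exists_isQuasiEq C D
    exact thm_imp_app_left e h₁ (ih hvs h₁) hE'
  | @appRight _ _ _ C D e _ ih =>
    obtain ⟨E₁, h₁⟩ := exists_isQuasiEq C D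
    exact thm_imp_app_right e h₁ (ih hvs h₁) hE'
  | @lam _ _ C D β n _ ih =>
    obtain ⟨E₁, h₁⟩ := exists_isQuasiEq C D
    -- The binder crossed here belongs to `vs`, so it is not free in `X` and may be generalized
    -- over.
    have h := thm_imp_eq_lam h₁ (ih (fun v hv => hvs v (List.mem_cons_of_mem _ hv)) h₁)
      (hvs _ List.mem_cons_self)
    exact (QEq.imp (.refl _) (hE'.qeq_eq (dfd_lam _ _ _) (dfd_lam _ _ _)).symm).thm h

/-! ### The deduction theorem -/

theorem Prv.of_thm {H : Set (Wff K o)} {A : Wff K o} (h : Thm A) : Prv H A := .base (.inr h)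

theorem Prv.mp {H : Set (Wff K o)} {A B : Wff K o} (h : Prv H (imp A B)) (h' : Prv H A) :
    Prv H B := Der.mp h' h

theorem Thm.mp_prv {H : Set (Wff K o)} {A B : Wff K o} (h : Thm (imp A B)) (h' : Prv H A) :
    Prv H B := (Prv.of_thm h).mp h'

theorem QEq.prv {H : Set (Wff K o)} {A B : Wff K o} (h : QEq A B) (h' : Prv H A) : Prv H B := by
  obtain ⟨E, hE, hT⟩ := h
  exact .rule (Prv.of_thm hT) h' ⟨o, A, B, [], hE, .here, by simp⟩

theorem Prv.imp_mp {H : Set (Wff K o)} {X A B : Wff K o} (h : Prv H (imp X (imp A B)))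
    (h' : Prv H (imp X A)) : Prv H (imp X B) :=
  ((thm_imp_distrib X A B).mp_prv h).mp h'

/-- Universal generalization. -/
theorem Prv.all {H : Set (Wff K o)} {A : Wff K o} (h : Prv H A) {α : Ty} {n : ℕ}
    (hn : ∀ G ∈ H, ¬ Free α n G) : Prv H (all α n A) := by
  obtain ⟨E, hE⟩ := exists_isQuasiEq tt A
  have h₁ : Prv H E :=
    ((hE.qeq_eq (dfd_o _) (dfd_o _)).trans (.tt_eq A)).symm.prv h
  -- R1 replaces the `T` under the binder in the theorem `∀ x T` by `A`; its side condition holds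
  -- because `x` is not free in `H`.
  refine .rule h₁ (Prv.of_thm (QEq.all_tt α n).thm_of_tt)
    ⟨o, tt, A, [(α, n)], hE, Repl.eq_right (.lam _ _ .here) _, ?_⟩
  simp only [List.mem_singleton, forall_eq]
  rintro ⟨⟨G, hG, hf⟩, -⟩
  exact hn G hG hf

theorem Prv.imp_all {H : Set (Wff K o)} {A P : Wff K o} (h : Prv H (imp A P)) {α : Ty} {n : ℕ}
    (hn : ∀ G ∈ H, ¬ Free α n G) (hA : ¬ Free α n A) : Prv H (imp A (Wff.all α n P)) :=
  (QEq.all_imp hA P).prv (h.all hn)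

/-- The wff `P`, generalized over those of the variables `vs` that are free in it. -/
theorem exists_generalization (vs : List (Ty × ℕ)) (P : Wff K o) : ∃ X : Wff K o,
    (∀ v ∈ vs, ¬ Free v.1 v.2 X) ∧ (∀ β n, Free β n X → Free β n P) ∧ Thm (imp X P) ∧
    ∀ (H : Set (Wff K o)) (A : Wff K o),
      (∀ v ∈ vs, ¬ ((∃ G ∈ H ∪ {A}, Free v.1 v.2 G) ∧ Free v.1 v.2 P)) →
      Prv H (imp A P) → Prv H (imp A X) := by
  induction vs with
  | nil => exact ⟨P, by simp, fun _ _ => id, (QEq.imp_self P).thm_of_tt, fun _ _ _ => id⟩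
  | cons v vs ih =>
    obtain ⟨X, hX, hf, hT, hP⟩ := ih
    -- Only a variable free in `X`, hence in `P`, is known to be absent from `H` and `A`. Any other
    -- may be free there, and needs no quantifier.
    by_cases hv : Free v.1 v.2 X
    · refine ⟨all v.1 v.2 X, ?_, ?_, (thm_all_imp _ _ _).imp_trans hT, ?_⟩
      · rintro w hw
        rw [free_all]
        rcases List.mem_cons.1 hw with rfl | hw
        · simp
        · exact fun h => hX w hw h.2
      · exact fun β n h => hf β n ((free_all _ _ _ _ _).1 h).2
      · intro H A hc h
        have hv' : ¬ ∃ G ∈ H ∪ {A}, Free v.1 v.2 G :=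
          fun h => hc v List.mem_cons_self ⟨h, hf _ _ hv⟩
        refine (hP H A (fun w hw => hc w (List.mem_cons_of_mem _ hw)) h).imp_all ?_ ?_
        · exact fun G hG hfr => hv' ⟨G, .inl hG, hfr⟩
        · exact fun hfr => hv' ⟨A, .inr rfl, hfr⟩
    · refine ⟨X, ?_, hf, hT, fun H A hc h =>
        hP H A (fun w hw => hc w (List.mem_cons_of_mem _ hw)) h⟩
      intro w hw
      rcases List.mem_cons.1 hw with rfl | hw
      · exact hv
      · exact hX w hw

theorem Prv.deduction {H : Set (Wff K o)} {A P : Wff K o} (h : Prv (H ∪ {A}) P) :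
    Prv H (imp A P) := by
  induction h with
  | base h =>
    rcases h with (h | rfl) | h
    · exact (thm_imp_imp_left _ _).mp_prv (.base (.inl h))
    · exact .of_thm (QEq.imp_self _).thm_of_tt
    · exact .of_thm (h.imp_intro _)
  | @rule E C D _ _ hR ihE ihC =>
    obtain ⟨α, B, B', vs, hE, hR, hc⟩ := hR
    obtain ⟨X, hX, -, hT, hP⟩ := exists_generalization vs E
    obtain ⟨E', hE'⟩ := exists_isQuasiEq C D
    have h₁ : Thm (imp X (imp C D)) :=
      (thm_imp_repl hE hT hR hX hE').imp_trans
        ((QEq.imp (hE'.qeq_eq (dfd_o _) (dfd_o _)).symm (.refl _)).thm (thm_eq_imp C D))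
    -- The side condition `hc` of R1 is exactly what carries `A ⊃ E` to `A ⊃ X`.
    exact (Prv.imp_mp (.of_thm (h₁.imp_intro A)) (hP H A hc ihE)).imp_mp ihC
  | mp _ _ ihC ihE => exact ihE.imp_mp ihC

end Wff

end Qu0

theorem mainTheorem6 {K : Qu0.Ty → Type u} (H : Set (Qu0.Wff K Qu0.Ty.o))
    (Ho Po : Qu0.Wff K Qu0.Ty.o) (h : Qu0.Wff.Proves (H ∪ {Ho}) Po) :
    Qu0.Wff.Proves H (Qu0.Wff.imp Ho Po) :=
  h.prv.deduction.proves
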